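/- Let $k$ be a field of characteristic $p>2$, let $R=W_2(k)$ be the ring of $p$-typical Witt vectors of length $2$ with Frobenius $\phi$, let $X$ be a smooth $R$-scheme with reduction $X_0=X\times_{\operatorname{Spec}R}\operatorname{Spec}k$, and let $F=F_{X_0}$ be the absolute Frobenius of $X_0$. Put $C_p(a,b)=\bigl(a^p+b^p-(a+b)^p\bigr)/p$, a polynomial with integer coefficients. For an $R$-algebra $A$ with $A_0=A\otimes_R k$, the module $\Omega^{1,\mathrm{tot}}_A$ of total $p$-differentials is the $A_0$-module generated by symbols $d^{\mathrm{tot}}x$ $(x\in A)$ with the relations $$d^{\mathrm{tot}}(a+b)=d^{\mathrm{tot}}a+d^{\mathrm{tot}}b+C_p(a,b)\,d^{\mathrm{tot}}p,\qquad d^{\mathrm{tot}}(ab)=b^p\,d^{\mathrm{tot}}a+a^p\,d^{\mathrm{tot}}b,\qquad d^{\mathrm{tot}}r=\tfrac{\phi(r)-r^p}{p}\,d^{\mathrm{tot}}p$$ for $a,b\in A$ and $r\in R$. These modules globalize to a sheaf $\Omega^{1,\mathrm{tot}}_X$ of $\mathcal O_{X_0}$-modules on $X_0$, with maps $\alpha\colon\mathcal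 O_{X_0}\to\Omega_X^{1,\mathrm{tot}}$, $\alpha(s)=s\,d^{\mathrm{tot}}p$, and $\beta\colon\Omega_X^{1,\mathrm{tot}}\to F^*\Omega^1_{X_0}$, $\beta(d^{\mathrm{tot}}x)=F^*(dx_0)$, where $\Omega^1_{X_0}=\Omega^1_{X_0/k}$ and $x_0$ is the reduction of $x$. Theorem. The sequence (the fundamental exact sequence) $$0\to\mathcal O_{X_0}\xrightarrow{\ \alpha\ }\Omega_X^{1,\mathrm{tot}}\xrightarrow{\ \beta\ }F^*\Omega^1_{X_0}\to0$$ is exact, and it remains exact after applying $\mathcal Hom_{\mathcal O_{X_0}}(F^*\Omega^1_{X_0},-)$. Let $\kappa\in H^1\bigl(X_0,\mathcal Hom(F^*\Omega^1_{X_0},\mathcal O_{X_0})\bigr)=\operatorname{Ext}^1(F^*\Omega^1_{X_0},\mathcal O_{X_0})$ be its extension class (the arithmetic Kodaira–Spencer class), that is, the image of $\mathrm{id}_{F^*\Omega^1_{X_0}}$ under the connecting map of the second exact sequence. Let $\mathrm{GM}\colon H^0(X_0,F^*\Omega^1_{X_0})\to H^1(X_0,\mathcal O_{X_0})$ (the arithmetic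 Gauss–Manin homomorphism) be the connecting map of the long exact cohomology sequence of the fundamental exact sequence. Then for every $\omega\in H^0(X_0,F^*\Omega^1_{X_0})$, $$\mathrm{GM}(\omega)=\omega\cup\kappa ,$$ where $\cup\colon H^0(X_0,F^*\Omega^1_{X_0})\times H^1\bigl(X_0,\mathcal Hom(F^*\Omega^1_{X_0},\mathcal O_{X_0})\bigr)\to H^1(X_0,\mathcal O_{X_0})$ is the cup product for the evaluation pairing; that is, $\omega\cup-$ is the map induced on $H^1$ by evaluation at $\omega$. -/

import Mathlib

open CategoryTheory AlgebraicGeometry TopologicalSpace Opposite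

universe u

namespace TotalPDiff

noncomputable section

/-- The polynomial `C_p(a, b) = (a ^ p + b ^ p - (a + b) ^ p) / p`, written out through the integers
`(p choose j) / p`, `0 < j < p`. See `natCast_mul_cPoly`. -/
def cPoly (p : ℕ) {A : Type u} [CommRing A] (a b : A) : A :=
  -∑ j ∈ Finset.Ioo 0 p, ((p.choose j / p : ℕ) : A) * (a ^ j * b ^ (p - j))

theorem natCast_mul_cPoly (p : ℕ) [hp : Fact p.Prime] {A : Type u} [CommRing A] (a b : A) :
    (p : A) * cPoly p a b = a ^ p + b ^ p - (a + b) ^ p := by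
  rw [Commute.add_pow_prime_eq' hp.out (Commute.all a b), cPoly]
  have : ∀ j, ((p.choose j / p : ℕ) : A) * (a ^ j * b ^ (p - j)) =
    a ^ j * b ^ (p - j) * ((p.choose j / p : ℕ) : A) := fun j ↦ mul_comm _ _
  simp only [this]
  ring

theorem cPoly_map {p : ℕ} {A B : Type u} [CommRing A] [CommRing B] (g : A →+* B) (a b : A) :
    g (cPoly p a b) = cPoly p (g a) (g b) := by
  simp [cPoly]

section Witt

variable (p : ℕ) [hp : Fact p.Prime] (k : Type u) [Field k]

/-- `W₂(k)`, the ring of `p`-typical Witt vectors of length `2`. -/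
abbrev W₂ : Type u := TruncatedWittVector p 2 k

/-- The reduction map `W₂(k) → k`, `(r₀, r₁) ↦ r₀`. -/
def residue : W₂ p k →+* k where
  toFun r := r.coeff 0
  map_one' := by
    have h : (1 : W₂ p k) = WittVector.truncate 2 1 := (map_one _).symm
    rw [h, WittVector.coeff_truncate]; exact WittVector.one_coeff_zero ..
  map_zero' := TruncatedWittVector.coeff_zero p 2 k 0
  map_mul' r s := by
    obtain ⟨x, rfl⟩ := WittVector.truncate_surjective p 2 k r
    obtain ⟨y, rfl⟩ := WittVector.truncate_surjective p 2 k s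
    simp only [← map_mul, WittVector.coeff_truncate]
    exact WittVector.mul_coeff_zero x y
  map_add' r s := by
    obtain ⟨x, rfl⟩ := WittVector.truncate_surjective p 2 k r
    obtain ⟨y, rfl⟩ := WittVector.truncate_surjective p 2 k s
    simp only [← map_add, WittVector.coeff_truncate]
    exact WittVector.add_coeff_zero x y

variable [CharP k p]

theorem truncate_frobenius_eq (x : WittVector p k) :
    WittVector.truncate 2 (WittVector.frobenius x) =
      TruncatedWittVector.mk p fun i ↦ (WittVector.truncate 2 x).coeff i ^ p := by
  ext i
  rw [WittVector.coeff_truncate, WittVector.coeff_frobenius_charP, TruncatedWittVector.coeff_mk,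
    WittVector.coeff_truncate]

/-- The Frobenius endomorphism `φ (r₀, r₁) = (r₀ ^ p, r₁ ^ p)` of `W₂(k)`. -/
def frob : W₂ p k →+* W₂ p k where
  toFun r := TruncatedWittVector.mk p fun i ↦ r.coeff i ^ p
  map_one' := by
    rw [← map_one (WittVector.truncate 2), ← truncate_frobenius_eq, map_one]
  map_zero' := by
    rw [← map_zero (WittVector.truncate 2), ← truncate_frobenius_eq, map_zero]
  map_mul' r s := by
    obtain ⟨x, rfl⟩ := WittVector.truncate_surjective p 2 k r
    obtain ⟨y, rfl⟩ := WittVector.truncate_surjective p 2 k s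
    rw [← map_mul, ← truncate_frobenius_eq, ← truncate_frobenius_eq, ← truncate_frobenius_eq,
      map_mul, map_mul]
  map_add' r s := by
    obtain ⟨x, rfl⟩ := WittVector.truncate_surjective p 2 k r
    obtain ⟨y, rfl⟩ := WittVector.truncate_surjective p 2 k s
    rw [← map_add, ← truncate_frobenius_eq, ← truncate_frobenius_eq, ← truncate_frobenius_eq,
      map_add, map_add]

end Witt

section Module

variable (p : ℕ) [hp : Fact p.Prime] {k : Type u} [Field k] [CharP k p]
  {A A₀ : Type u} [CommRing A] [CommRing A₀] (ρ : W₂ p k →+* A) (π : A →+* A₀)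

/-- A total `p`-derivation of the `W₂(k)`-algebra `A` (structure map `ρ`) into a module `D` over
`A₀` (reduction map `π : A → A₀`). In the third axiom `c` is any value of `(φ(r) - r ^ p) / p`. -/
structure IsTotalPDerivation {D : Type u} [AddCommGroup D] [Module A₀ D] (δ : A → D) : Prop where
  add (a b : A) : δ (a + b) = δ a + δ b + π (cPoly p a b) • δ p
  mul (a b : A) : δ (a * b) = π (b ^ p) • δ a + π (a ^ p) • δ b
  scalar (r c : W₂ p k) (h : (p : W₂ p k) * c = frob p k r - r ^ p) : δ (ρ r) = π (ρ c) • δ p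

/-- The relations between the symbols `d x`, `x ∈ A`, in the free `A₀`-module on them. -/
def relations : Submodule A₀ (A →₀ A₀) :=
  let d : A → (A →₀ A₀) := fun x ↦ Finsupp.single x 1
  Submodule.span A₀
    ({m | ∃ a b : A, m = d (a + b) - (d a + d b + π (cPoly p a b) • d p)} ∪
     {m | ∃ a b : A, m = d (a * b) - (π (b ^ p) • d a + π (a ^ p) • d b)} ∪
     {m | ∃ r c : W₂ p k, (p : W₂ p k) * c = frob p k r - r ^ p ∧
        m = d (ρ r) - π (ρ c) • d p})

/-- The module of total `p`-differentials. -/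
def TotalDifferentials : Type u := (A →₀ A₀) ⧸ relations p ρ π

instance : AddCommGroup (TotalDifferentials p ρ π) :=
  inferInstanceAs (AddCommGroup ((A →₀ A₀) ⧸ relations p ρ π))

instance : Module A₀ (TotalDifferentials p ρ π) :=
  inferInstanceAs (Module A₀ ((A →₀ A₀) ⧸ relations p ρ π))

/-- The universal total `p`-derivation `dᵗᵒᵗ`. -/
def d (x : A) : TotalDifferentials p ρ π :=
  (relations p ρ π).mkQ (Finsupp.single x 1)

theorem isTotalPDerivation_d : IsTotalPDerivation p ρ π (d p ρ π) where
  add a b := by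
    rw [← sub_eq_zero]
    refine ((relations p ρ π).mkQ.map_sub _ _).symm.trans
      ((Submodule.Quotient.mk_eq_zero _).2 (Submodule.subset_span ?_))
    exact Or.inl (Or.inl ⟨a, b, rfl⟩)
  mul a b := by
    rw [← sub_eq_zero]
    refine ((relations p ρ π).mkQ.map_sub _ _).symm.trans
      ((Submodule.Quotient.mk_eq_zero _).2 (Submodule.subset_span ?_))
    exact Or.inl (Or.inr ⟨a, b, rfl⟩)
  scalar r c h := by
    rw [← sub_eq_zero]
    refine ((relations p ρ π).mkQ.map_sub _ _).symm.trans
      ((Submodule.Quotient.mk_eq_zero _).2 (Submodule.subset_span ?_))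
    exact Or.inr ⟨r, c, h, rfl⟩

variable {p ρ π}

theorem hom_ext {D : Type u} [AddCommGroup D] [Module A₀ D]
    {f g : TotalDifferentials p ρ π →ₗ[A₀] D} (h : ∀ x, f (d p ρ π x) = g (d p ρ π x)) : f = g := by
  refine Submodule.linearMap_qext _ (Finsupp.lhom_ext' fun x ↦ LinearMap.ext_ring ?_)
  exact h x

theorem modHom_ext {M : ModuleCat.{u} A₀}
    {f g : ModuleCat.of A₀ (TotalDifferentials p ρ π) ⟶ M}
    (h : ∀ x, f.hom (d p ρ π x) = g.hom (d p ρ π x)) : f = g :=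
  ModuleCat.hom_ext (hom_ext h)

/-- The linear map induced by a total `p`-derivation. -/
def lift {D : Type u} [AddCommGroup D] [Module A₀ D] {δ : A → D}
    (hδ : IsTotalPDerivation p ρ π δ) : TotalDifferentials p ρ π →ₗ[A₀] D :=
  (relations p ρ π).liftQ (Finsupp.linearCombination A₀ δ) <| by
    rw [relations, Submodule.span_le]
    rintro m ((⟨a, b, rfl⟩ | ⟨a, b, rfl⟩) | ⟨r, c, h, rfl⟩)
    · simp [hδ.add]
    · simp [hδ.mul]
    · simp [hδ.scalar r c h]

@[simp]
theorem lift_d {D : Type u} [AddCommGroup D] [Module A₀ D] {δ : A → D}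
    (hδ : IsTotalPDerivation p ρ π δ) (x : A) : lift hδ (d p ρ π x) = δ x := by
  refine ((relations p ρ π).liftQ_apply _ _).trans ?_
  simp

end Module

section Scalars

variable {S : CommRingCat.{u}} {Y : Scheme.{u}} (g : Y ⟶ Spec S)

/-- The structure map `S → Γ(Y, U)` of a scheme over `Spec S`. -/
def scalars (U : Y.Opens) : S ⟶ Γ(Y, U) :=
  (Scheme.ΓSpecIso S).inv ≫ g.appTop ≫ Y.presheaf.map (homOfLE le_top).op

theorem scalars_map {U V : (Y.Opens)ᵒᵖ} (h : U ⟶ V) :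
    scalars g U.unop ≫ Y.presheaf.map h = scalars g V.unop := by
  simp only [scalars, Category.assoc, ← Functor.map_comp]
  rfl

/-- The structure maps `S → Γ(Y, U)`, as a morphism from the constant presheaf. -/
def scalarsHom : (CategoryTheory.Functor.const _).obj S ⟶ Y.presheaf where
  app U := scalars g U.unop
  naturality U V h := by simp [scalars_map]

end Scalars

/-- The sheaf of modules attached to a presheaf of modules on a scheme. -/
abbrev sheafify {Y : Scheme.{u}} (M : Y.PresheafOfModules) : Y.Modules :=
  (PresheafOfModules.sheafification (𝟙 Y.ringCatSheaf.obj)).obj M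

/-- The sheaf `Ω¹` of Kähler differentials of a scheme `Y` over `Spec S`, the sheaf attached to
`U ↦ Ω_{Γ(Y, U) / S}`. -/
def kaehler {S : CommRingCat.{u}} {Y : Scheme.{u}} (g : Y ⟶ Spec S) : Y.Modules :=
  sheafify (PresheafOfModules.DifferentialsConstruction.relativeDifferentials' (scalarsHom g))

section Frobenius

variable (p : ℕ) [hp : Fact p.Prime] {k : Type u} [Field k] [CharP k p]

/-- The Frobenius endomorphism of a commutative ring receiving a homomorphism from a field of
characteristic `p`. -/
def powHom {A : Type u} [CommRing A] (g : k →+* A) : A →+* A where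
  toFun x := x ^ p
  map_one' := one_pow p
  map_zero' := zero_pow hp.out.ne_zero
  map_mul' x y := mul_pow x y p
  map_add' x y := by
    have hpA : (p : A) = 0 := by rw [← map_natCast g, CharP.cast_eq_zero, map_zero]
    have h := natCast_mul_cPoly p x y
    rw [hpA, zero_mul] at h
    exact (sub_eq_zero.1 h.symm).symm

variable {p}

/-- The identity on points and `s ↦ s ^ p` on sections, on the underlying ringed spaces. -/
def absFrobeniusPresheafed {Y : Scheme.{u}} (g : Y ⟶ Spec (CommRingCat.of k)) :
    Y.toPresheafedSpace.Hom Y.toPresheafedSpace where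
  base := 𝟙 _
  c :=
    { app U := CommRingCat.ofHom (powHom p (scalars g U.unop).hom)
      naturality U V h := by
        ext x
        exact (map_pow (Y.presheaf.map h).hom x p).symm }

/-- The absolute Frobenius morphism of a scheme `Y` over a field of characteristic `p`: the identity
on points and `s ↦ s ^ p` on sections. -/
def absFrobenius {Y : Scheme.{u}} (g : Y ⟶ Spec (CommRingCat.of k)) : Y ⟶ Y where
  toHom := absFrobeniusPresheafed (p := p) g
  prop x := by
    refine ⟨fun a ha ↦ ?_⟩
    obtain ⟨U, hx, s, rfl⟩ := TopCat.Presheaf.exists_germ_eq Y.presheaf a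
    have e := ConcreteCategory.congr_hom (PresheafedSpace.stalkMap_germ
      (X := Y.toPresheafedSpace) (Y := Y.toPresheafedSpace) (absFrobeniusPresheafed (p := p) g)
      U x hx) s
    have e' : (PresheafedSpace.Hom.stalkMap (absFrobeniusPresheafed (p := p) g) x).hom
        ((Y.presheaf.germ U x hx).hom s) = (Y.presheaf.germ U x hx).hom s ^ p :=
      e.trans (map_pow (Y.presheaf.germ U x hx).hom s p)
    exact (isUnit_pow_iff hp.out.ne_zero).1 (e' ▸ ha)

theorem absFrobenius_app {Y : Scheme.{u}} (g : Y ⟶ Spec (CommRingCat.of k)) (U : Y.Opens)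
    (s : Γ(Y, U)) : (absFrobenius (p := p) g).app U s = s ^ p := rfl

end Frobenius

section Residue

variable {p : ℕ} [hp : Fact p.Prime] {k : Type u} [Field k]

theorem residue_surjective : Function.Surjective (residue p k) := fun x ↦
  ⟨TruncatedWittVector.mk p fun _ ↦ x, TruncatedWittVector.coeff_mk (p := p) (fun _ : Fin 2 ↦ x) 0⟩

instance : IsClosedImmersion (Spec.map (CommRingCat.ofHom (residue p k))) :=
  IsClosedImmersion.spec_of_surjective _ residue_surjective

end Residue

section Reduction

variable {p : ℕ} [hp : Fact p.Prime] {k : Type u} [Field k] [CharP k p]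
  {X : Scheme.{u}} (f : X ⟶ Spec (CommRingCat.of (W₂ p k)))

/-- The reduction `X₀ = X ×_{Spec W₂(k)} Spec k`. -/
abbrev reduction : Scheme.{u} :=
  Limits.pullback f (Spec.map (CommRingCat.ofHom (residue p k)))

/-- The inclusion `X₀ → X`. -/
abbrev incl : reduction f ⟶ X := Limits.pullback.fst _ _

/-- The structure morphism `X₀ → Spec k`. -/
abbrev redStr : reduction f ⟶ Spec (CommRingCat.of k) := Limits.pullback.snd _ _

theorem pow_eq_zero_of_residue (r : W₂ p k) (h : residue p k r = 0) : r ^ 2 = 0 := by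
  obtain ⟨x, rfl⟩ := WittVector.truncate_surjective p 2 k r
  have hx : x.coeff 0 = 0 := (WittVector.coeff_truncate x 0).symm.trans h
  obtain ⟨y, rfl⟩ : ∃ y, x = WittVector.verschiebung y :=
    ⟨x.shift 1, by
      refine (Eq.trans (WittVector.verschiebung_shift x 0 (by simpa using hx)) ?_).symm
      ext n
      simp [WittVector.shift_coeff]⟩
  have hp0 : ((p : ℕ) : WittVector p k).coeff 0 = 0 := by
    have := map_natCast (WittVector.constantCoeff (p := p) (R := k)) p
    exact this.trans (CharP.cast_eq_zero k p)
  rw [sq, ← map_mul, ← WittVector.verschiebung_mul_frobenius, ← RingHom.mem_ker,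
    WittVector.mem_ker_truncate]
  intro i hi
  interval_cases i
  · exact WittVector.verschiebung_coeff_zero _
  · rw [WittVector.verschiebung_coeff_succ, WittVector.frobenius_verschiebung,
      WittVector.mul_coeff_zero, WittVector.mul_coeff_zero, hp0, mul_zero, mul_zero]

instance : Surjective (Spec.map (CommRingCat.ofHom (residue p k))) :=
  ⟨(PrimeSpectrum.isHomeomorph_comap (residue p k)
    (fun x ↦ ⟨1, one_pos, by simpa using residue_surjective x⟩)
    (fun r hr ↦ ⟨2, pow_eq_zero_of_residue r hr⟩)).surjective⟩

theorem incl_isHomeomorph : IsHomeomorph (incl f) :=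
  isHomeomorph_iff_isEmbedding_surjective.2
    ⟨(incl f).isClosedEmbedding.isEmbedding, (incl f).surjective⟩

/-- The open subset of `X` with the same points as the open subset `U` of `X₀`. -/
def imageOpens (U : (reduction f).Opens) : X.Opens :=
  ⟨incl f '' U, (incl_isHomeomorph f).isOpenMap _ U.2⟩

theorem le_preimage_imageOpens (U : (reduction f).Opens) : U ≤ incl f ⁻¹ᵁ imageOpens f U :=
  fun x hx ↦ ⟨x, hx, rfl⟩

theorem imageOpens_mono {U V : (reduction f).Opens} (h : U ≤ V) :
    imageOpens f U ≤ imageOpens f V := Set.image_mono h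

/-- The reduction map `π : 𝒪_X → 𝒪_{X₀}` on an open subset. -/
def redMap (U : (reduction f).Opens) : Γ(X, imageOpens f U) ⟶ Γ(reduction f, U) :=
  (incl f).appLE (imageOpens f U) U (le_preimage_imageOpens f U)

/-- The restriction map of `𝒪_X` between open subsets of `X₀`. -/
def resMap {U V : ((reduction f).Opens)ᵒᵖ} (h : U ⟶ V) :
    Γ(X, imageOpens f U.unop) ⟶ Γ(X, imageOpens f V.unop) :=
  X.presheaf.map (homOfLE (imageOpens_mono f h.unop.le)).op

theorem resMap_redMap {U V : ((reduction f).Opens)ᵒᵖ} (h : U ⟶ V) :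
    resMap f h ≫ redMap f V.unop = redMap f U.unop ≫ (reduction f).presheaf.map h := by
  simp [resMap, redMap, Scheme.Hom.map_appLE, Scheme.Hom.appLE_map]

theorem scalars_resMap {U V : ((reduction f).Opens)ᵒᵖ} (h : U ⟶ V) :
    scalars f (imageOpens f U.unop) ≫ resMap f h = scalars f (imageOpens f V.unop) :=
  scalars_map f _

/-- Total `p`-differentials of `Γ(X, U)`, with coefficients in `Γ(X₀, U)`. -/
abbrev TotOn (U : (reduction f).Opens) : Type u :=
  TotalDifferentials p (scalars f (imageOpens f U)).hom (redMap f U).hom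

/-- The universal total `p`-derivation `Γ(X, U) → TotOn f U`. -/
abbrev dOn (U : (reduction f).Opens) (x : Γ(X, imageOpens f U)) : TotOn f U :=
  d p (scalars f (imageOpens f U)).hom (redMap f U).hom x

end Reduction

section Presheaf

variable {p : ℕ} [hp : Fact p.Prime] {k : Type u} [Field k] [CharP k p]
  {X : Scheme.{u}} (f : X ⟶ Spec (CommRingCat.of (W₂ p k)))

theorem isTotalPDerivation_res {U V : ((reduction f).Opens)ᵒᵖ} (h : U ⟶ V) :
    letI : Module Γ(reduction f, U.unop) (TotOn f V.unop) :=
      Module.compHom _ ((reduction f).presheaf.map h).hom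
    IsTotalPDerivation p (scalars f (imageOpens f U.unop)).hom (redMap f U.unop).hom
      (fun x ↦ dOn f V.unop (resMap f h x)) := by
  have key (a) : ((reduction f).presheaf.map h).hom ((redMap f U.unop).hom a) =
      (redMap f V.unop).hom ((resMap f h).hom a) :=
    (ConcreteCategory.congr_hom (resMap_redMap f h) a).symm
  have hd := isTotalPDerivation_d p (scalars f (imageOpens f V.unop)).hom (redMap f V.unop).hom
  let _ : Module Γ(reduction f, U.unop) (TotOn f V.unop) :=
      Module.compHom _ ((reduction f).presheaf.map h).hom
  have hs (r : Γ(reduction f, U.unop)) (m : TotOn f V.unop) :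
    r • m = ((reduction f).presheaf.map h).hom r • m := rfl
  have hp : resMap f h (p : Γ(X, imageOpens f U.unop)) = (p : Γ(X, imageOpens f V.unop)) :=
    map_natCast (resMap f h).hom p
  constructor
  · intro a b
    rw [hs, key, cPoly_map, hp, ← hd.add]
    exact congrArg (dOn f V.unop) (map_add (resMap f h).hom a b)
  · intro a b
    have hpow (a : Γ(X, imageOpens f U.unop)) :
        (resMap f h).hom (a ^ p) = (resMap f h).hom a ^ p := map_pow _ a p
    rw [hs, hs, key, key, hpow, hpow]
    refine Eq.trans ?_ (hd.mul _ _)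
    exact congrArg (dOn f V.unop) (map_mul (resMap f h).hom a b)
  · intro r c hrc
    have hr (r) : (resMap f h).hom ((scalars f (imageOpens f U.unop)).hom r) =
      (scalars f (imageOpens f V.unop)).hom r := ConcreteCategory.congr_hom (scalars_resMap f h) r
    rw [hs, key, hp, hr c]
    exact (congrArg (dOn f V.unop) (hr r)).trans (hd.scalar r c hrc)

/-- The restriction maps of total `p`-differentials, `s • d x ↦ s|_V • d (x|_V)`. -/
def totRes {U V : ((reduction f).Opens)ᵒᵖ} (h : U ⟶ V) :
    ModuleCat.of Γ(reduction f, U.unop) (TotOn f U.unop) ⟶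
      (ModuleCat.restrictScalars ((reduction f).presheaf.map h).hom).obj
        (ModuleCat.of Γ(reduction f, V.unop) (TotOn f V.unop)) :=
  ModuleCat.ofHom (Y := (ModuleCat.restrictScalars ((reduction f).presheaf.map h).hom).obj
        (ModuleCat.of Γ(reduction f, V.unop) (TotOn f V.unop)))
    (letI : Module Γ(reduction f, U.unop) (TotOn f V.unop) :=
      Module.compHom _ ((reduction f).presheaf.map h).hom
    lift (isTotalPDerivation_res f h))

theorem totRes_d {U V : ((reduction f).Opens)ᵒᵖ} (h : U ⟶ V) (x) :
    (totRes f h).hom (dOn f U.unop x) = dOn f V.unop (resMap f h x) :=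
  let _ : Module Γ(reduction f, U.unop) (TotOn f V.unop) :=
      Module.compHom _ ((reduction f).presheaf.map h).hom
  lift_d (isTotalPDerivation_res f h) x

/-- The presheaf `U ↦ Ωᵗᵒᵗ(Γ(X, U))` of modules on `X₀`. -/
def totPresheaf : (reduction f).PresheafOfModules where
  obj U := ModuleCat.of Γ(reduction f, U.unop) (TotOn f U.unop)
  map h := totRes f h
  map_id U := by
    refine ModuleCat.hom_ext (hom_ext fun x ↦ ?_)
    refine (totRes_d f (𝟙 U) x).trans ?_
    exact congrArg (dOn f U.unop) (ConcreteCategory.congr_hom (X.presheaf.map_id _) x)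
  map_comp {U V W} h h' := by
    refine ModuleCat.hom_ext (hom_ext fun x ↦ ?_)
    refine (totRes_d f (h ≫ h') x).trans ?_
    refine Eq.trans ?_ ((congrArg (totRes f h').hom (totRes_d f h x)).trans
      (totRes_d f h' (resMap f h x))).symm
    exact congrArg (dOn f W.unop) (ConcreteCategory.congr_hom (X.presheaf.map_comp _ _) x)

/-- The sheaf `Ω^{1,tot}_X` of total `p`-differentials, a sheaf of modules on `X₀`. -/
def total : (reduction f).Modules := sheafify (totPresheaf f)

end Presheaf

section Sequence

/-- The canonical map from a presheaf of modules to the attached sheaf, on sections over `U`. -/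
def toSheafify {Y : Scheme.{u}} (M : Y.PresheafOfModules) (U : Y.Opens) :
    M.obj (op U) →+ Γ(sheafify M, U) :=
  (((PresheafOfModules.sheafificationAdjunction
    (𝟙 Y.ringCatSheaf.obj)).unit.app M).app (op U)).hom.toAddMonoidHom

theorem toSheafify_smul {Y : Scheme.{u}} (M : Y.PresheafOfModules) (U : Y.Opens)
    (r : Y.ringCatSheaf.obj.obj (op U)) (m : M.obj (op U)) :
    toSheafify M U (r • m) = (show Γ(Y, U) from r) • toSheafify M U m :=
  (((PresheafOfModules.sheafificationAdjunction
    (𝟙 Y.ringCatSheaf.obj)).unit.app M).app (op U)).hom.map_smul r m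

theorem toSheafify_map {Y : Scheme.{u}} (M : Y.PresheafOfModules) {U V : Y.Opens} (h : V ⟶ U)
    (m : M.obj (op U)) :
    toSheafify M V (M.map h.op m) = (sheafify M).presheaf.map h.op (toSheafify M U m) :=
  PresheafOfModules.naturality_apply
    ((PresheafOfModules.sheafificationAdjunction (𝟙 Y.ringCatSheaf.obj)).unit.app M) h.op m

variable {p : ℕ} [hp : Fact p.Prime] {k : Type u} [Field k] [CharP k p]

/-- The universal derivation `d : 𝒪_Y → Ω¹` on sections over `U`. -/
def kaehlerD {S : CommRingCat.{u}} {Y : Scheme.{u}} (g : Y ⟶ Spec S) (U : Y.Opens)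
    (s : Γ(Y, U)) : Γ(kaehler g, U) :=
  toSheafify _ U ((PresheafOfModules.DifferentialsConstruction.derivation' (scalarsHom g)).d s)

/-- `F^* Ω¹_Y` for the absolute Frobenius `F` of a scheme `Y` over a field of characteristic `p`. -/
abbrev frobKaehler {Y : Scheme.{u}} (g : Y ⟶ Spec (CommRingCat.of k)) : Y.Modules :=
  (Scheme.Modules.pullback (absFrobenius (p := p) g)).obj (kaehler g)

/-- Pull-back of sections along the absolute Frobenius, `Γ(U, M) → Γ(U, F^* M)`. -/
def frobPull {Y : Scheme.{u}} (g : Y ⟶ Spec (CommRingCat.of k)) (M : Y.Modules) (U : Y.Opens) :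
    Γ(M, U) →+ Γ((Scheme.Modules.pullback (absFrobenius (p := p) g)).obj M, U) :=
  (((Scheme.Modules.pullbackPushforwardAdjunction (absFrobenius (p := p) g)).unit.app M).app U).hom

theorem frobPull_smul {Y : Scheme.{u}} (g : Y ⟶ Spec (CommRingCat.of k)) (M : Y.Modules)
    (U : Y.Opens) (r : Γ(Y, U)) (m : Γ(M, U)) :
    frobPull (p := p) g M U (r • m) = r ^ p • frobPull (p := p) g M U m :=
  ((Scheme.Modules.pullbackPushforwardAdjunction
    (absFrobenius (p := p) g)).unit.app M).app_smul r m

section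

variable {S : CommRingCat.{u}} {Y : Scheme.{u}} (g : Y ⟶ Spec S)

theorem kaehlerD_add (U : Y.Opens) (a b : Γ(Y, U)) :
    kaehlerD g U (a + b) = kaehlerD g U a + kaehlerD g U b := by
  refine Eq.trans (congrArg (toSheafify _ U) (map_add
    (PresheafOfModules.DifferentialsConstruction.derivation' (scalarsHom g)).d a b)) ?_
  exact map_add _ _ _

theorem kaehlerD_mul (U : Y.Opens) (a b : Γ(Y, U)) :
    kaehlerD g U (a * b) = a • kaehlerD g U b + b • kaehlerD g U a := by
  refine Eq.trans (congrArg (toSheafify _ U)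
    ((PresheafOfModules.DifferentialsConstruction.derivation' (scalarsHom g)).d_mul a b)) ?_
  refine (map_add _ _ _).trans (congrArg₂ _ ?_ ?_)
  · exact toSheafify_smul _ U _ _
  · exact toSheafify_smul _ U _ _

theorem kaehlerD_scalars (U : Y.Opens) (r : S) :
    kaehlerD g U (scalars g U r) = 0 := by
  refine Eq.trans (congrArg (toSheafify _ U)
    ((PresheafOfModules.DifferentialsConstruction.derivation' (scalarsHom g)).d_app
      (X := op U) r)) ?_
  exact map_zero _

theorem kaehlerD_map {U V : Y.Opens} (h : V ⟶ U) (s : Γ(Y, U)) :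
    kaehlerD g V (Y.presheaf.map h.op s) = (kaehler g).presheaf.map h.op (kaehlerD g U s) := by
  refine Eq.trans (congrArg (toSheafify _ V)
    ((PresheafOfModules.DifferentialsConstruction.derivation' (scalarsHom g)).d_map h.op s)) ?_
  exact toSheafify_map _ h _

end

theorem frobPull_map {Y : Scheme.{u}} (g : Y ⟶ Spec (CommRingCat.of k)) (M : Y.Modules)
    {U V : Y.Opens} (h : V ⟶ U) (m : Γ(M, U)) :
    frobPull (p := p) g M V (M.presheaf.map h.op m) =
      ((Scheme.Modules.pullback (absFrobenius (p := p) g)).obj M).presheaf.map h.op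
        (frobPull (p := p) g M U m) :=
  ConcreteCategory.congr_hom ((((Scheme.Modules.pullbackPushforwardAdjunction
    (absFrobenius (p := p) g)).unit.app M).mapPresheaf).naturality h.op) m

variable {X : Scheme.{u}} (f : X ⟶ Spec (CommRingCat.of (W₂ p k)))

theorem redMap_scalars (U : (reduction f).Opens) (r : W₂ p k) :
    redMap f U (scalars f (imageOpens f U) r) = scalars (redStr f) U (residue p k r) := by
  have h : scalars f (imageOpens f U) ≫ redMap f U =
      CommRingCat.ofHom (residue p k) ≫ scalars (redStr f) U := by
    have hc : f.appTop ≫ (incl f).appTop =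
        (Spec.map (CommRingCat.ofHom (residue p k))).appTop ≫ (redStr f).appTop := by
      rw [← Scheme.Hom.comp_appTop, ← Scheme.Hom.comp_appTop, Limits.pullback.condition]
    have h1 : X.presheaf.map (homOfLE le_top).op ≫ redMap f U =
        (incl f).appTop ≫ (reduction f).presheaf.map (homOfLE le_top).op := by
      simp only [redMap, Scheme.Hom.map_appLE]
      rfl
    simp only [scalars, Category.assoc, h1]
    rw [reassoc_of% hc, ← Scheme.ΓSpecIso_inv_naturality_assoc]
  exact ConcreteCategory.congr_hom h r

theorem isTotalPDerivation_frob (U : (reduction f).Opens) :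
    IsTotalPDerivation p (scalars f (imageOpens f U)).hom (redMap f U).hom
      (D := Γ(frobKaehler (p := p) (redStr f), U))
      (fun x ↦ frobPull (redStr f) _ U (kaehlerD (redStr f) U (redMap f U x))) := by
  have hp0 : frobPull (p := p) (redStr f) _ U
      (kaehlerD (redStr f) U (redMap f U (p : Γ(X, imageOpens f U)))) = 0 := by
    have : redMap f U (p : Γ(X, imageOpens f U)) = scalars (redStr f) U (p : k) :=
      (map_natCast (redMap f U).hom p).trans (map_natCast (scalars (redStr f) U).hom p).symm
    rw [this, kaehlerD_scalars, map_zero]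
  constructor
  · intro a b
    rw [hp0, smul_zero, add_zero]
    refine Eq.trans ?_ (map_add _ _ _)
    refine congrArg (frobPull (redStr f) _ U) ?_
    refine Eq.trans ?_ (kaehlerD_add _ _ _ _)
    exact congrArg (kaehlerD (redStr f) U) (map_add (redMap f U).hom a b)
  · intro a b
    rw [add_comm, map_pow, map_pow]
    refine Eq.trans ?_ (congrArg₂ _ (frobPull_smul (redStr f) _ U _ _)
      (frobPull_smul (redStr f) _ U _ _))
    refine Eq.trans ?_ (map_add _ _ _)
    refine congrArg (frobPull (redStr f) _ U) ?_
    refine Eq.trans ?_ (kaehlerD_mul _ _ _ _)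
    exact congrArg (kaehlerD (redStr f) U) (map_mul (redMap f U).hom a b)
  · intro r c _
    rw [hp0, smul_zero]
    refine Eq.trans ?_ (map_zero (frobPull (redStr f) _ U))
    refine congrArg (frobPull (redStr f) _ U) ?_
    refine Eq.trans ?_ (kaehlerD_scalars (redStr f) U (residue p k r))
    exact congrArg (kaehlerD (redStr f) U) (redMap_scalars f U r)

/-- The map `Ωᵗᵒᵗ(Γ(X, U)) → Γ(U, F^* Ω¹)` with `dᵗᵒᵗ x ↦ F^* d x₀`. -/
def betaPre : totPresheaf f ⟶ (SheafOfModules.forget _ ⋙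
      PresheafOfModules.restrictScalars (𝟙 (reduction f).ringCatSheaf.obj)).obj
        (frobKaehler (p := p) (redStr f)) where
  app U := show ModuleCat.of Γ(reduction f, U.unop) (TotOn f U.unop) ⟶
      ModuleCat.of Γ(reduction f, U.unop) Γ(frobKaehler (p := p) (redStr f), U.unop) from
    ModuleCat.ofHom (lift (isTotalPDerivation_frob f U.unop))
  naturality {U V} h := by
    refine modHom_ext (A₀ := Γ(reduction f, U.unop)) fun x ↦ ?_
    refine (congrArg (lift (isTotalPDerivation_frob f V.unop)) (totRes_d f h x)).trans ?_
    refine (lift_d (isTotalPDerivation_frob f V.unop) _).trans ?_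
    refine Eq.trans ?_ (congrArg ((frobKaehler (p := p) (redStr f)).presheaf.map h)
      (lift_d (isTotalPDerivation_frob f U.unop) x)).symm
    refine Eq.trans ?_ (frobPull_map (redStr f) _ h.unop _)
    refine congrArg (frobPull (redStr f) _ V.unop) ?_
    refine Eq.trans ?_ (kaehlerD_map (redStr f) h.unop _)
    exact congrArg (kaehlerD (redStr f) V.unop) (ConcreteCategory.congr_hom (resMap_redMap f h) x)

/-- The map `β : Ω^{1,tot}_X → F^* Ω¹_{X₀}`, `dᵗᵒᵗ x ↦ F^* d x₀`. -/
def beta : total f ⟶ frobKaehler (p := p) (redStr f) :=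
  ((PresheafOfModules.sheafificationAdjunction
    (𝟙 (reduction f).ringCatSheaf.obj)).homEquiv _ _).symm (betaPre f)

/-- The universal total `p`-derivation `dᵗᵒᵗ : 𝒪_X → Ω^{1,tot}_X`. -/
def dTot (U : (reduction f).Opens) (x : Γ(X, imageOpens f U)) : Γ(total f, U) :=
  toSheafify (totPresheaf f) U (dOn f U x)

theorem beta_dTot (U : (reduction f).Opens) (x : Γ(X, imageOpens f U)) :
    (beta f).app U (dTot f U x) =
      frobPull (redStr f) _ U (kaehlerD (redStr f) U (redMap f U x)) := by
  have h : (PresheafOfModules.sheafificationAdjunction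
      (𝟙 (reduction f).ringCatSheaf.obj)).homEquiv _ _ (beta f) = betaPre f :=
    Equiv.apply_symm_apply _ _
  have h' := congrArg (fun φ ↦ (φ.app (op U)).hom (dOn f U x))
    ((Adjunction.homEquiv_unit _ _ _ _).symm.trans h)
  exact h'.trans (lift_d (isTotalPDerivation_frob f U) x)

/-- The global section `dᵗᵒᵗ p` of `Ω^{1,tot}_X`. -/
def dTotP : (total f : SheafOfModules _).sections :=
  PresheafOfModules.sectionsMk (fun U ↦ dTot f U.unop p) fun U V h ↦ by
    refine (toSheafify_map (totPresheaf f) h.unop (dOn f U.unop p)).symm.trans ?_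
    refine congrArg (toSheafify (totPresheaf f) V.unop) ((totRes_d f h _).trans ?_)
    exact congrArg (dOn f V.unop) (map_natCast (resMap f h).hom p)

/-- The structure sheaf, as a module over itself. -/
abbrev structureSheaf (Y : Scheme.{u}) : Y.Modules := SheafOfModules.unit Y.ringCatSheaf

/-- The map `α : 𝒪_{X₀} → Ω^{1,tot}_X`, `s ↦ s • dᵗᵒᵗ p`. -/
def alpha : structureSheaf (reduction f) ⟶ total f :=
  (SheafOfModules.unitHomEquiv (total f)).symm (dTotP f)

theorem alpha_app (U : (reduction f).Opens) (s : Γ(reduction f, U)) :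
    (alpha f).app U s = s • dTot f U p := rfl

theorem alpha_beta : alpha f ≫ beta f = 0 := by
  refine Scheme.Modules.hom_ext _ _ fun U ↦ ?_
  ext s
  refine (congrArg ((beta f).app U) (alpha_app f U s)).trans ?_
  refine ((beta f).app_smul s (dTot f U p)).trans ?_
  rw [beta_dTot]
  have : redMap f U (p : Γ(X, imageOpens f U)) = scalars (redStr f) U (p : k) :=
    (map_natCast (redMap f U).hom p).trans (map_natCast (scalars (redStr f) U).hom p).symm
  rw [this, kaehlerD_scalars, map_zero]
  exact smul_zero (A := Γ(frobKaehler (p := p) (redStr f), U)) (show Γ(reduction f, U) from s)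

/-- The fundamental sequence `0 → 𝒪_{X₀} → Ω^{1,tot}_X → F^* Ω¹_{X₀} → 0`. -/
abbrev fundamental : ShortComplex (reduction f).Modules :=
  ShortComplex.mk (alpha f) (beta f) (alpha_beta f)

end Sequence

section Hom

variable {Y : Scheme.{u}}

/-- `Hom_{𝒪_U}(M|_U, N|_U)`: the families of `Γ(Y, V)`-linear maps `Γ(M, V) → Γ(N, V)`, `V ≤ U`,
that commute with the restriction maps. -/
def homOn (M N : Y.Modules) (U : Y.Opens) :
    AddSubgroup (∀ V : {V : Y.Opens // V ≤ U}, Γ(M, V.1) →ₗ[Γ(Y, V.1)] Γ(N, V.1)) where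
  carrier := {φ | ∀ (V W : {V : Y.Opens // V ≤ U}) (h : W.1 ⟶ V.1) (m : Γ(M, V.1)),
    φ W (M.presheaf.map h.op m) = N.presheaf.map h.op (φ V m)}
  zero_mem' _ _ h _ := (map_zero (N.presheaf.map h.op).hom).symm
  add_mem' hφ hψ V W h m :=
    (congrArg₂ _ (hφ V W h m) (hψ V W h m)).trans (map_add (N.presheaf.map h.op).hom _ _).symm
  neg_mem' hφ V W h m :=
    (congrArg _ (hφ V W h m)).trans (map_neg (N.presheaf.map h.op).hom _).symm

/-- Restriction of homomorphisms to a smaller open subset. -/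
def homRes (M N : Y.Modules) {U U' : Y.Opens} (h : U' ≤ U) : homOn M N U →+ homOn M N U' where
  toFun φ := ⟨fun V ↦ φ.1 ⟨V.1, V.2.trans h⟩, fun V W i m ↦
    φ.2 ⟨V.1, V.2.trans h⟩ ⟨W.1, W.2.trans h⟩ i m⟩
  map_zero' := rfl
  map_add' _ _ := rfl

/-- The presheaf `U ↦ Hom_{𝒪_U}(M|_U, N|_U)`. -/
def homPresheaf (M N : Y.Modules) : TopCat.Presheaf AddCommGrpCat.{u} Y where
  obj U := AddCommGrpCat.of (homOn M N U.unop)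
  map h := AddCommGrpCat.ofHom (homRes M N h.unop.le)

theorem map_map_apply (M : Y.Modules) {U V W : Y.Opens} (h : V ⟶ U) (h' : W ⟶ V) (h'' : W ⟶ U)
    (m : Γ(M, U)) :
    M.presheaf.map h'.op (M.presheaf.map h.op m) = M.presheaf.map h''.op m :=
  (ConcreteCategory.congr_hom (M.presheaf.map_comp h.op h'.op) m).symm

theorem homPresheaf_isSheaf (M N : Y.Modules) : (homPresheaf M N).IsSheaf := by
  refine (TopCat.Presheaf.isSheaf_iff_isSheafUniqueGluing _).2 fun ι U sf hsf ↦ ?_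
  let φ (i : ι) : homOn M N (U i) := sf i
  have hφ (i j : ι) (V : Y.Opens) (hi : V ≤ U i) (hj : V ≤ U j) :
      (φ i).1 ⟨V, hi⟩ = (φ j).1 ⟨V, hj⟩ :=
    congrArg (fun ψ : homOn M N (U i ⊓ U j) ↦ ψ.1 ⟨V, le_inf hi hj⟩) (hsf i j)
  let F : TopCat.Sheaf AddCommGrpCat.{u} Y := ⟨N.presheaf, N.isSheaf⟩
  have hcov (V : Y.Opens) (hV : V ≤ iSup U) : V ≤ ⨆ i, V ⊓ U i := by
    rw [← inf_iSup_eq]; exact le_inf le_rfl hV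
  let r (V : Y.Opens) (i : ι) : V ⊓ U i ⟶ V := homOfLE inf_le_left
  have huniq (V : Y.Opens) (hV : V ≤ iSup U) (n n' : Γ(N, V))
      (h : ∀ i, N.presheaf.map (r V i).op n = N.presheaf.map (r V i).op n') : n = n' :=
    F.eq_of_locally_eq' _ V (r V) (hcov V hV) n n' h
  have hex (V : Y.Opens) (hV : V ≤ iSup U) (m : Γ(M, V)) : ∃ n : Γ(N, V), ∀ i,
      N.presheaf.map (r V i).op n = (φ i).1 ⟨V ⊓ U i, inf_le_right⟩ (M.presheaf.map (r V i).op m) := by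
    obtain ⟨n, hn, -⟩ := F.existsUnique_gluing' (fun i ↦ V ⊓ U i) V (r V) (hcov V hV)
      (fun i ↦ (φ i).1 ⟨V ⊓ U i, inf_le_right⟩ (M.presheaf.map (r V i).op m)) (by
        intro i j
        have hi : (V ⊓ U i) ⊓ (V ⊓ U j) ≤ U i := inf_le_left.trans inf_le_right
        have hj : (V ⊓ U i) ⊓ (V ⊓ U j) ≤ U j := inf_le_right.trans inf_le_right
        refine ((φ i).2 ⟨V ⊓ U i, inf_le_right⟩ ⟨_, hi⟩ (Opens.infLELeft _ _) _).symm.trans ?_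
        refine Eq.trans ?_ ((φ j).2 ⟨V ⊓ U j, inf_le_right⟩ ⟨_, hj⟩ (Opens.infLERight _ _) _)
        rw [hφ i j _ hi hj]
        refine congrArg _ ?_
        rw [map_map_apply M (r V i) (Opens.infLELeft _ _) (homOfLE (inf_le_left.trans inf_le_left)),
          map_map_apply M (r V j) (Opens.infLERight _ _) (homOfLE (inf_le_left.trans inf_le_left))])
    exact ⟨n, hn⟩
  choose G hG using hex
  let Φ : homOn M N (iSup U) := ⟨fun V ↦
    { toFun := G V.1 V.2
      map_add' m m' := huniq V.1 V.2 _ _ fun i ↦ by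
        rw [hG, map_add, map_add, map_add, hG, hG]
      map_smul' s m := huniq V.1 V.2 _ _ fun i ↦ by
        rw [hG, Scheme.Modules.map_smul, map_smul, RingHom.id_apply, Scheme.Modules.map_smul, hG] },
    fun V W h m ↦ huniq W.1 W.2 _ _ fun i ↦ by
      refine (hG W.1 W.2 _ i).trans ?_
      have h1 : W.1 ⊓ U i ≤ V.1 ⊓ U i := inf_le_inf_right _ h.le
      rw [map_map_apply M h (r W.1 i) (homOfLE (h1.trans inf_le_left)),
        ← map_map_apply M (r V.1 i) (homOfLE h1)]
      refine ((φ i).2 ⟨V.1 ⊓ U i, inf_le_right⟩ ⟨W.1 ⊓ U i, inf_le_right⟩ (homOfLE h1) _).trans ?_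
      rw [← hG V.1 V.2]
      refine (map_map_apply N (r V.1 i) (homOfLE h1) (homOfLE (h1.trans inf_le_left)) _).trans ?_
      exact (map_map_apply N h (r W.1 i) _ _).symm⟩
  have hΦ (ψ : homOn M N (iSup U)) : (∀ i, homRes M N (le_iSup U i) ψ = φ i) ↔ ψ = Φ := by
    constructor
    · intro h
      refine Subtype.ext (funext fun V ↦ LinearMap.ext fun m ↦ huniq V.1 V.2 _ _ fun i ↦ ?_)
      refine Eq.trans ?_ (hG V.1 V.2 m i).symm
      rw [← h i]
      exact (ψ.2 V ⟨V.1 ⊓ U i, inf_le_left.trans V.2⟩ (r V.1 i) m).symm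
    · rintro rfl i
      refine Subtype.ext (funext fun V ↦ LinearMap.ext fun m ↦ ?_)
      have hV := V.2.trans (le_iSup U i)
      refine huniq V.1 hV _ _ fun j ↦ (hG V.1 hV m j).trans ?_
      rw [← hφ i j (V.1 ⊓ U j) (inf_le_left.trans V.2) inf_le_right]
      exact (φ i).2 V ⟨V.1 ⊓ U j, inf_le_left.trans V.2⟩ (r V.1 j) m
  exact ⟨Φ, (hΦ Φ).2 rfl, fun ψ hψ ↦ (hΦ ψ).1 hψ⟩

/-- The sheaf `ℋom(M, N)` of homomorphisms of `𝒪_Y`-modules. -/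
def homSheaf (M N : Y.Modules) : Sheaf (Opens.grothendieckTopology Y) AddCommGrpCat.{u} :=
  ⟨homPresheaf M N, homPresheaf_isSheaf M N⟩

/-- Composition with `g : N → N'`, as a map `ℋom(M, N) → ℋom(M, N')`. -/
def homSheafMap (M : Y.Modules) {N N' : Y.Modules} (g : N ⟶ N') :
    homSheaf M N ⟶ homSheaf M N' where
  hom :=
    { app U := AddCommGrpCat.ofHom
        { toFun φ := ⟨fun V ↦
            { toFun m := g.app V.1 (φ.1 V m)
              map_add' m m' := by rw [map_add, map_add]
              map_smul' r m := by rw [map_smul, g.app_smul]; rfl }, fun V W h m ↦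
            (congrArg (g.app W.1) (φ.2 V W h m)).trans
              (ConcreteCategory.congr_hom (g.mapPresheaf.naturality h.op) (φ.1 V m))⟩
          map_zero' := Subtype.ext (funext fun V ↦ LinearMap.ext fun m ↦ map_zero (g.app V.1).hom)
          map_add' φ ψ := Subtype.ext (funext fun V ↦ LinearMap.ext fun m ↦
            map_add (g.app V.1).hom (φ.1 V m) (ψ.1 V m)) }
      naturality U V h := rfl }

/-- The underlying abelian sheaf of a sheaf of modules. -/
abbrev abelianSheaf (Y : Scheme.{u}) :
    Y.Modules ⥤ Sheaf (Opens.grothendieckTopology Y) AddCommGrpCat.{u} :=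
  SheafOfModules.toSheaf Y.ringCatSheaf

instance (Y : Scheme.{u}) : (abelianSheaf Y).PreservesZeroMorphisms where
  map_zero _ _ := rfl

/-- Evaluation of homomorphisms at a global section `ω` of `M`, a map `ℋom(M, N) → N`. -/
def evalAt {M : Y.Modules} (N : Y.Modules) (ω : Γ(M, ⊤)) :
    homSheaf M N ⟶ (abelianSheaf Y).obj N where
  hom :=
    { app U := AddCommGrpCat.ofHom
        { toFun φ := φ.1 ⟨U.unop, le_rfl⟩ (M.presheaf.map (homOfLE le_top).op ω)
          map_zero' := rfl
          map_add' _ _ := rfl }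
      naturality U V h := by
        ext φ
        refine Eq.trans ?_ (φ.2 ⟨U.unop, le_rfl⟩ ⟨V.unop, h.unop.le⟩ h.unop _)
        exact congrArg (φ.1 ⟨V.unop, h.unop.le⟩) (map_map_apply M _ h.unop _ ω).symm }

/-- The identity of `M`, as a global section of `ℋom(M, M)`. -/
def idSection (M : Y.Modules) : (homSheaf M M).obj.obj (op ⊤) :=
  (⟨fun _ ↦ LinearMap.id, fun _ _ _ _ ↦ rfl⟩ : homOn M M ⊤)

end Hom

section Cohomology

variable {Y : Scheme.{u}}

/-- `Hⁿ(Y, F)`, for an abelian sheaf `F`. -/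
abbrev Coh (F : Sheaf (Opens.grothendieckTopology Y) AddCommGrpCat.{u}) (n : ℕ) : Type u :=
  Sheaf.H F n

/-- `H⁰(Y, F)` is the group of global sections. -/
def globalSections (F : Sheaf (Opens.grothendieckTopology Y) AddCommGrpCat.{u}) :
    Coh F 0 ≃+ F.obj.obj (op ⊤) :=
  Sheaf.H.equiv₀ F Limits.isTerminalTop

/-- The connecting map `Hⁿ(Y, S₃) → Hⁿ⁺¹(Y, S₁)` of the long exact cohomology sequence of
`0 → S₁ → S₂ → S₃ → 0`. -/
def connecting {S : ShortComplex (Sheaf (Opens.grothendieckTopology Y) AddCommGrpCat.{u})}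
    (hS : S.ShortExact) (n : ℕ) : Coh S.X₃ n →+ Coh S.X₁ (n + 1) :=
  hS.extClass.postcomp _ rfl

/-- Cup product `H⁰(Y, M) × Hⁿ(Y, ℋom(M, N)) → Hⁿ(Y, N)` for the evaluation pairing
`M × ℋom(M, N) → N`: a class in `H⁰` is a global section `ω` of `M`, and the cup product with it is
the map induced in cohomology by the pairing with `ω`. -/
def cup {M N : Y.Modules} {n : ℕ} (ω : Coh ((abelianSheaf Y).obj M) 0) (c : Coh (homSheaf M N) n) :
    Coh ((abelianSheaf Y).obj N) n :=
  Sheaf.H.map (evalAt N (globalSections _ ω)) n c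

/-- For a sequence `S₁ → S₂ → S₃` of `𝒪_Y`-modules, the sequence
`ℋom(S₃, S₁) → ℋom(S₃, S₂) → ℋom(S₃, S₃)`. -/
abbrev homSequence (S : ShortComplex Y.Modules) :
    ShortComplex (Sheaf (Opens.grothendieckTopology Y) AddCommGrpCat.{u}) :=
  ShortComplex.mk (homSheafMap S.X₃ S.f) (homSheafMap S.X₃ S.g) (by
    refine Sheaf.hom_ext (NatTrans.ext (funext fun U ↦ ?_))
    ext φ
    refine Subtype.ext (funext fun V ↦ LinearMap.ext fun m ↦ ?_)
    exact congrArg (fun g : S.X₁ ⟶ S.X₃ ↦ g.app V.1 (φ.1 V m)) S.zero)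

/-- The class of a locally split extension `0 → S₁ → S₂ → S₃ → 0` in
`H¹(Y, ℋom(S₃, S₁))`: the coboundary of the identity of `S₃`. -/
def extensionClass (S : ShortComplex Y.Modules) (hS : (homSequence S).ShortExact) :
    Coh (homSheaf S.X₃ S.X₁) 1 :=
  connecting hS 0 ((globalSections _).symm (idSection S.X₃))

end Cohomology

section Main

variable {p : ℕ} [hp : Fact p.Prime] {k : Type u} [Field k] [CharP k p]
  {X : Scheme.{u}} (f : X ⟶ Spec (CommRingCat.of (W₂ p k)))

/-- The arithmetic Gauss-Manin homomorphism `H⁰(X₀, F^* Ω¹) → H¹(X₀, 𝒪)`: the connecting map of the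
fundamental sequence. -/
def gaussManin (h : ((fundamental f).map (abelianSheaf (reduction f))).ShortExact) :
    Coh ((abelianSheaf (reduction f)).obj (frobKaehler (p := p) (redStr f))) 0 →+
      Coh ((abelianSheaf (reduction f)).obj (structureSheaf (reduction f))) 1 :=
  connecting h 0

/-- The arithmetic Kodaira-Spencer class `κ ∈ H¹(X₀, ℋom(F^* Ω¹, 𝒪))`: the class of the
fundamental sequence as an extension. -/
def kodairaSpencer (h : (homSequence (fundamental f)).ShortExact) :
    Coh (homSheaf (frobKaehler (p := p) (redStr f)) (structureSheaf (reduction f))) 1 :=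
  extensionClass (fundamental f) h

end Main

end

end TotalPDiff

/-! Everything rests on the dictionary between total `p`-derivations and Witt vectors. If `s : A →
W₂(A₀)` is a ring homomorphism that lifts the reduction `π` and is compatible with `W₂(k)`, then its
second component `δ` is a total `p`-derivation into `A₀` with `δ(p) = 1`
(`IsWittLift.isTotalPDerivation`), because `C_p` is exactly the term that enters the second
component of a sum of Witt vectors. The kernel of `W₂(A₀) → A₀` has square zero, so smoothness of
`A` over `W₂(k)` provides such an `s` (`exists_isWittLift`).

One lift splits the sequence from both sides. The linear map induced by `δ` sends `dᵗᵒᵗ p` to `1`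
and so retracts `α`. The difference `x ↦ dᵗᵒᵗ x - δ(x) dᵗᵒᵗ p` (`splitting`) is additive, is a
Frobenius-semilinear derivation and kills `W₂(k)`; it therefore descends to `𝒪_{X₀}` and defines a
section `σ` of `β`. These are complementary: `m = σ(β m) + δ(m) dᵗᵒᵗ p` (`totToSheaf_eq`). To obtain
`σ` as a map of sheaves over an affine open, the lift must be extended to all smaller affine opens;
restriction maps between affine opens are formally étale, so the extension exists, is unique and
hence is compatible (`exists_compatible_lifts`).

The retractions give injectivity of `α` and exactness in the middle, and the sections give
surjectivity of `β`. As the sequence is locally split, it stays exact under `ℋom(F^* Ω¹, -)`.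

The formula for the connecting map is formal and holds for any such extension
(`connecting_eq_cup_extensionClass`): evaluation at `ω` is a morphism from the sequence of `ℋom`
sheaves to the original one, it sends the identity to `ω`, and connecting maps are natural. -/

namespace TotalPDiff

noncomputable section

/-! ### Witt vectors of length two in coordinates. -/

section WittCoeff

variable (p : ℕ) [hp : Fact p.Prime] {B C : Type u} [CommRing B] [CommRing C]

open MvPolynomial in
-- The ghost component of index `1` is `X₀ ^ p + p X₁`. Additivity of it gives the identity
-- multiplied by `p`, and `p` cancels over `ℤ`. The same argument serves `wittMul_one_eq`.
theorem wittAdd_one_eq :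
    WittVector.wittAdd p 1 = X (0, 1) + X (1, 1) + cPoly p (X (0, 0)) (X (1, 0)) := by
  have h := wittStructureInt_prop p (X 0 + X 1 : MvPolynomial (Fin 2) ℤ) 1
  have h0 : wittStructureInt p (X 0 + X 1 : MvPolynomial (Fin 2) ℤ) 0 = X (0, 0) + X (1, 0) :=
    WittVector.wittAdd_zero p
  have hW : wittPolynomial p ℤ 1 = X 0 ^ p + C (p : ℤ) * X 1 := by
    simp [wittPolynomial_eq_sum_C_mul_X_pow, Finset.sum_range_succ]
  have hp0 : (p : MvPolynomial (Fin 2 × ℕ) ℤ) ≠ 0 := Nat.cast_ne_zero.2 hp.out.ne_zero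
  simp only [hW, map_add, map_mul, map_pow, bind₁_X_right, rename_X, h0, algHom_C,
    algebraMap_eq] at h
  refine mul_left_cancel₀ hp0 ?_
  rw [mul_add, natCast_mul_cPoly, WittVector.wittAdd]
  simp only [map_natCast] at h
  linear_combination h

open MvPolynomial in
theorem wittMul_one_eq :
    WittVector.wittMul p 1 = X (0, 0) ^ p * X (1, 1) + X (1, 0) ^ p * X (0, 1) +
      (p : MvPolynomial (Fin 2 × ℕ) ℤ) * (X (0, 1) * X (1, 1)) := by
  have h := wittStructureInt_prop p (X 0 * X 1 : MvPolynomial (Fin 2) ℤ) 1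
  have h0 : wittStructureInt p (X 0 * X 1 : MvPolynomial (Fin 2) ℤ) 0 = X (0, 0) * X (1, 0) :=
    WittVector.wittMul_zero p
  have hW : wittPolynomial p ℤ 1 = X 0 ^ p + C (p : ℤ) * X 1 := by
    simp [wittPolynomial_eq_sum_C_mul_X_pow, Finset.sum_range_succ]
  have hp0 : (p : MvPolynomial (Fin 2 × ℕ) ℤ) ≠ 0 := Nat.cast_ne_zero.2 hp.out.ne_zero
  simp only [hW, map_add, map_mul, map_pow, bind₁_X_right, rename_X, h0, algHom_C,
    algebraMap_eq] at h
  refine mul_left_cancel₀ hp0 ?_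
  rw [WittVector.wittMul]
  simp only [map_natCast] at h
  linear_combination h

variable {p}

theorem wittVector_add_coeff_one (x y : WittVector p B) :
    (x + y).coeff 1 = x.coeff 1 + y.coeff 1 + cPoly p (x.coeff 0) (y.coeff 0) := by
  rw [WittVector.add_coeff, WittVector.peval, wittAdd_one_eq]
  simp [cPoly]

theorem wittVector_mul_coeff_one (x y : WittVector p B) :
    (x * y).coeff 1 = x.coeff 0 ^ p * y.coeff 1 + y.coeff 0 ^ p * x.coeff 1 +
      p * (x.coeff 1 * y.coeff 1) := by
  rw [WittVector.mul_coeff, WittVector.peval, wittMul_one_eq]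
  simp

theorem add_coeff_one (x y : TruncatedWittVector p 2 B) :
    (x + y).coeff 1 = x.coeff 1 + y.coeff 1 + cPoly p (x.coeff 0) (y.coeff 0) := by
  obtain ⟨x, rfl⟩ := WittVector.truncate_surjective p 2 B x
  obtain ⟨y, rfl⟩ := WittVector.truncate_surjective p 2 B y
  simp only [← map_add, WittVector.coeff_truncate]
  exact wittVector_add_coeff_one x y

theorem mul_coeff_one (x y : TruncatedWittVector p 2 B) :
    (x * y).coeff 1 = x.coeff 0 ^ p * y.coeff 1 + y.coeff 0 ^ p * x.coeff 1 +
      p * (x.coeff 1 * y.coeff 1) := by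
  obtain ⟨x, rfl⟩ := WittVector.truncate_surjective p 2 B x
  obtain ⟨y, rfl⟩ := WittVector.truncate_surjective p 2 B y
  simp only [← map_mul, WittVector.coeff_truncate]
  exact wittVector_mul_coeff_one x y

theorem natCast_coeff_one [CharP B p] : (p : TruncatedWittVector p 2 B).coeff 1 = 1 := by
  rw [← map_natCast (WittVector.truncate 2), WittVector.coeff_truncate]
  exact WittVector.coeff_p_one p B

variable (p B) in
/-- The reduction map `W₂(B) → B`, `(r₀, r₁) ↦ r₀`. -/
def coeffZero : TruncatedWittVector p 2 B →+* B where
  toFun r := r.coeff 0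
  map_one' := by
    rw [← map_one (WittVector.truncate 2), WittVector.coeff_truncate]
    exact WittVector.one_coeff_zero ..
  map_zero' := TruncatedWittVector.coeff_zero p 2 B 0
  map_mul' r s := by
    obtain ⟨x, rfl⟩ := WittVector.truncate_surjective p 2 B r
    obtain ⟨y, rfl⟩ := WittVector.truncate_surjective p 2 B s
    simp only [← map_mul, WittVector.coeff_truncate]
    exact WittVector.mul_coeff_zero x y
  map_add' r s := by
    obtain ⟨x, rfl⟩ := WittVector.truncate_surjective p 2 B r
    obtain ⟨y, rfl⟩ := WittVector.truncate_surjective p 2 B s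
    simp only [← map_add, WittVector.coeff_truncate]
    exact WittVector.add_coeff_zero x y

theorem coeffZero_apply (r : TruncatedWittVector p 2 B) : coeffZero p B r = r.coeff 0 := rfl

theorem coeffZero_surjective : Function.Surjective (coeffZero p B) := fun x ↦
  ⟨TruncatedWittVector.mk p fun _ ↦ x, TruncatedWittVector.coeff_mk (p := p) (fun _ : Fin 2 ↦ x) 0⟩

omit hp [CommRing B] in
theorem truncatedWittVector_ext {x y : TruncatedWittVector p 2 B} (h0 : x.coeff 0 = y.coeff 0)
    (h1 : x.coeff 1 = y.coeff 1) : x = y :=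
  TruncatedWittVector.ext (Fin.forall_fin_two.2 ⟨h0, h1⟩)

/-- Elements of the kernel are `(0, x₁)`, and a product of two of them is `(0, p x₁ y₁) = 0`. -/
theorem isNilpotent_ker_coeffZero (hB : (p : B) = 0) :
    IsNilpotent (RingHom.ker (coeffZero p B)) := by
  refine ⟨2, ?_⟩
  rw [sq, Ideal.zero_eq_bot, eq_bot_iff, Ideal.mul_le]
  intro x hx y hy
  rw [RingHom.mem_ker] at hx hy
  refine truncatedWittVector_ext ?_ ?_
  · rw [← coeffZero_apply, map_mul, hx, zero_mul]
    exact (map_zero (coeffZero p B)).symm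
  · rw [mul_coeff_one, ← coeffZero_apply, ← coeffZero_apply, hx, hy, hB,
      zero_pow hp.out.ne_zero, TruncatedWittVector.coeff_zero]
    simp

theorem truncate_map_eq (g : B →+* C) (x : WittVector p B) :
    WittVector.truncate 2 (WittVector.map g x) =
      TruncatedWittVector.mk p fun i ↦ g ((WittVector.truncate 2 x).coeff i) := by
  ext i
  rw [WittVector.coeff_truncate, WittVector.map_coeff, TruncatedWittVector.coeff_mk,
    WittVector.coeff_truncate]

/-- The map `W₂(B) → W₂(C)` induced by a ring homomorphism `B → C`. -/
def wittMap (g : B →+* C) : TruncatedWittVector p 2 B →+* TruncatedWittVector p 2 C where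
  toFun r := TruncatedWittVector.mk p fun i ↦ g (r.coeff i)
  map_one' := by
    rw [← map_one (WittVector.truncate 2), ← truncate_map_eq, map_one, map_one]
  map_zero' := by
    rw [← map_zero (WittVector.truncate 2), ← truncate_map_eq, map_zero, map_zero]
  map_mul' r s := by
    obtain ⟨x, rfl⟩ := WittVector.truncate_surjective p 2 B r
    obtain ⟨y, rfl⟩ := WittVector.truncate_surjective p 2 B s
    rw [← map_mul, ← truncate_map_eq, ← truncate_map_eq, ← truncate_map_eq, map_mul, map_mul]
  map_add' r s := by
    obtain ⟨x, rfl⟩ := WittVector.truncate_surjective p 2 B r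
    obtain ⟨y, rfl⟩ := WittVector.truncate_surjective p 2 B s
    rw [← map_add, ← truncate_map_eq, ← truncate_map_eq, ← truncate_map_eq, map_add, map_add]

theorem wittMap_coeff (g : B →+* C) (r : TruncatedWittVector p 2 B) (i : Fin 2) :
    (wittMap g r).coeff i = g (r.coeff i) :=
  TruncatedWittVector.coeff_mk (p := p) (fun i : Fin 2 ↦ g (r.coeff i)) i

theorem pow_coeff_one (hB : (p : B) = 0) (x : TruncatedWittVector p 2 B) (n : ℕ) :
    (x ^ (n + 1)).coeff 1 = (n + 1) * (x.coeff 0 ^ (n * p) * x.coeff 1) := by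
  induction n with
  | zero => simp
  | succ n ih =>
    rw [pow_succ, mul_coeff_one, ih, hB, ← coeffZero_apply, map_pow, coeffZero_apply]
    push_cast
    ring

omit hp in
theorem cPoly_zero_left (b : B) : cPoly p 0 b = 0 := by
  rw [cPoly, neg_eq_zero]
  refine Finset.sum_eq_zero fun j hj ↦ ?_
  rw [zero_pow (Finset.mem_Ioo.1 hj).1.ne', zero_mul, mul_zero]

variable {k : Type u} [Field k] [CharP k p]

theorem frob_coeff (r : W₂ p k) (i : Fin 2) : (frob p k r).coeff i = r.coeff i ^ p :=
  TruncatedWittVector.coeff_mk (p := p) (fun i : Fin 2 ↦ r.coeff i ^ p) i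

/-- In coordinates `p c = (0, c₀ ^ p)`, `r ^ p = (r₀ ^ p, 0)` and `φ(r) = (r₀ ^ p, r₁ ^ p)`, so the
equation says `c₀ ^ p = r₁ ^ p`, and Frobenius is injective on a field. Thus `(φ(r) - r ^ p) / p` is
determined only modulo the kernel of `W₂(k) → k`, and its residue is `r₁`. -/
theorem natCast_mul_add_pow_eq_frob_iff (r c : W₂ p k) :
    (p : W₂ p k) * c = frob p k r - r ^ p ↔ c.coeff 0 = r.coeff 1 := by
  have hk : (p : k) = 0 := CharP.cast_eq_zero k p
  have hp0 : (p : W₂ p k).coeff 0 = 0 :=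
    (map_natCast (coeffZero p k) p).trans hk
  have h0 : ((p : W₂ p k) * c + r ^ p).coeff 0 = (frob p k r).coeff 0 := by
    rw [frob_coeff, ← coeffZero_apply, map_add, map_mul, map_natCast, hk, map_pow, zero_mul,
      zero_add, coeffZero_apply]
  have h1 : ((p : W₂ p k) * c + r ^ p).coeff 1 = c.coeff 0 ^ p := by
    -- By `pow_coeff_one` the second component of `r ^ p` is a multiple of the exponent `p`, hence
    -- zero.
    obtain ⟨n, hn⟩ := Nat.exists_eq_succ_of_ne_zero hp.out.ne_zero
    have hr : (r ^ p).coeff 1 = 0 := by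
      have h (m : ℕ) (hm : m = n + 1) :
          (r ^ m).coeff 1 = (m : k) * (r.coeff 0 ^ (n * p) * r.coeff 1) := by
        rw [hm, pow_coeff_one hk]
        push_cast
        rfl
      rw [h p hn, hk, zero_mul]
    have h00 : ((p : W₂ p k) * c).coeff 0 = 0 := by
      rw [← coeffZero_apply, map_mul, map_natCast, hk, zero_mul]
    rw [add_coeff_one, hr, h00, cPoly_zero_left, mul_coeff_one, hp0, hk, natCast_coeff_one,
      zero_pow hp.out.ne_zero]
    ring
  rw [eq_sub_iff_add_eq]
  refine ⟨fun h ↦ frobenius_inj k p ?_, fun h ↦ truncatedWittVector_ext h0 ?_⟩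
  · have := congrArg (fun x : W₂ p k ↦ x.coeff 1) h
    simp only [h1, frob_coeff] at this
    exact this
  · rw [h1, h, frob_coeff]

theorem exists_natCast_mul_eq (r : W₂ p k) : ∃ c : W₂ p k, (p : W₂ p k) * c = frob p k r - r ^ p :=
  -- Only the first component of `c` matters; the second is arbitrary.
  ⟨TruncatedWittVector.mk p fun _ ↦ r.coeff 1, (natCast_mul_add_pow_eq_frob_iff _ _).2
    (TruncatedWittVector.coeff_mk (p := p) (fun _ : Fin 2 ↦ r.coeff 1) 0)⟩

end WittCoeff

/-! ### Lifts to `W₂(A₀)` and total `p`-derivations. -/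

section Sections

variable {p : ℕ} [hp : Fact p.Prime] {k : Type u} [Field k]
  {A A₀ B : Type u} [CommRing A] [CommRing A₀] [CommRing B]

/-- A lift `A → W₂(A₀)` of the reduction map `π : A → A₀` over `W₂(k)`. -/
structure IsWittLift (ρ : W₂ p k →+* A) (π : A →+* A₀) (g : k →+* A₀)
    (s : A →+* TruncatedWittVector p 2 A₀) : Prop where
  comp_structure : s.comp ρ = wittMap g
  coeffZero_comp : (coeffZero p A₀).comp s = π

theorem IsWittLift.apply_structure {ρ : W₂ p k →+* A} {π : A →+* A₀} {g : k →+* A₀}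
    {s : A →+* TruncatedWittVector p 2 A₀} (hs : IsWittLift ρ π g s) (r : W₂ p k) :
    s (ρ r) = wittMap g r := RingHom.congr_fun hs.comp_structure r

theorem IsWittLift.coeff_zero {ρ : W₂ p k →+* A} {π : A →+* A₀} {g : k →+* A₀}
    {s : A →+* TruncatedWittVector p 2 A₀} (hs : IsWittLift ρ π g s) (a : A) :
    (s a).coeff 0 = π a := RingHom.congr_fun hs.coeffZero_comp a

theorem comp_structure_eq_comp_residue {ρ : W₂ p k →+* A} {π : A →+* A₀} {g : k →+* A₀}
    {s : A →+* TruncatedWittVector p 2 A₀} (hs : IsWittLift ρ π g s) (r : W₂ p k) :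
    π (ρ r) = g (residue p k r) := by
  rw [← hs.coeff_zero, hs.apply_structure, wittMap_coeff]
  rfl

variable [CharP k p]

omit hp in
theorem natCast_eq_zero_of_hom (g : k →+* A₀) : (p : A₀) = 0 := by
  rw [← map_natCast g, CharP.cast_eq_zero, map_zero]

theorem IsWittLift.coeff_one_natCast {ρ : W₂ p k →+* A} {π : A →+* A₀} {g : k →+* A₀}
    {s : A →+* TruncatedWittVector p 2 A₀} (hs : IsWittLift ρ π g s) :
    (s (p : A)).coeff 1 = 1 := by
  rw [← map_natCast ρ, hs.apply_structure, wittMap_coeff, natCast_coeff_one, map_one]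

/-- The second component of a lift `A → W₂(A₀)` is a total `p`-derivation. -/
theorem IsWittLift.isTotalPDerivation {ρ : W₂ p k →+* A} {π : A →+* A₀} {g : k →+* A₀}
    {s : A →+* TruncatedWittVector p 2 A₀} (hs : IsWittLift ρ π g s) :
    IsTotalPDerivation p ρ π fun a ↦ (s a).coeff 1 where
  add a b := by
    rw [map_add, add_coeff_one, hs.coeff_one_natCast, hs.coeff_zero, hs.coeff_zero, cPoly_map,
      smul_eq_mul, mul_one]
  mul a b := by
    rw [map_mul, mul_coeff_one, hs.coeff_zero, hs.coeff_zero, natCast_eq_zero_of_hom g, zero_mul,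
      add_zero, map_pow, map_pow, add_comm]
    rfl
  scalar r c h := by
    rw [hs.coeff_one_natCast, hs.apply_structure, wittMap_coeff, comp_structure_eq_comp_residue hs,
      smul_eq_mul, mul_one, ← (natCast_mul_add_pow_eq_frob_iff r c).1 h]
    rfl

theorem exists_isWittLift {ρ : W₂ p k →+* A} (hρ : ρ.FormallySmooth) {π : A →+* A₀} {g : k →+* A₀}
    (h : ∀ r, π (ρ r) = g (residue p k r)) : ∃ s, IsWittLift ρ π g s := by
  algebraize [ρ]
  -- With this algebra structure `W₂(k)`-linearity of the lift is the condition `comp_structure`.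
  let _ : Algebra (W₂ p k) (TruncatedWittVector p 2 A₀) := (wittMap g).toAlgebra
  let _ : Algebra (W₂ p k) A₀ := (π.comp ρ).toAlgebra
  let q : TruncatedWittVector p 2 A₀ →ₐ[W₂ p k] A₀ :=
    { coeffZero p A₀ with
      commutes' r := (wittMap_coeff g r 0).trans (h r).symm }
  let π' : A →ₐ[W₂ p k] A₀ := { π with commutes' r := rfl }
  have hq : Function.Surjective q := coeffZero_surjective
  have hn : IsNilpotent (RingHom.ker (q : TruncatedWittVector p 2 A₀ →+* A₀)) :=
    isNilpotent_ker_coeffZero (natCast_eq_zero_of_hom g)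
  let s := Algebra.FormallySmooth.liftOfSurjective π' q hq hn
  exact ⟨s, RingHom.ext fun r ↦ s.commutes r,
    RingHom.ext fun a ↦ Algebra.FormallySmooth.liftOfSurjective_apply π' q hq hn a⟩

/-- A lift to `W₂` extends uniquely along a formally étale homomorphism. -/
theorem existsUnique_wittLift_extension {B₀ : Type u} [CommRing B₀] {ρ : W₂ p k →+* A}
    {π : A →+* A₀} {g : k →+* A₀} {s : A →+* TruncatedWittVector p 2 A₀} (hs : IsWittLift ρ π g s)
    {τ : A →+* B} (hτ : τ.FormallyEtale) {τ₀ : A₀ →+* B₀} {π' : B →+* B₀}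
    (h : π'.comp τ = τ₀.comp π) :
    ∃! t : B →+* TruncatedWittVector p 2 B₀,
      t.comp τ = (wittMap τ₀).comp s ∧ (coeffZero p B₀).comp t = π' := by
  algebraize [τ]
  -- `W₂(B₀)` is an `A`-algebra through `s`, so the homomorphisms `t` sought are the `A`-linear
  -- lifts of `π'` along a nilpotent thickening; smoothness gives existence and unramifiedness gives
  -- uniqueness.
  let _ : Algebra A (TruncatedWittVector p 2 B₀) := ((wittMap τ₀).comp s).toAlgebra
  let _ : Algebra A B₀ := (π'.comp τ).toAlgebra
  have hk : (p : B₀) = 0 := natCast_eq_zero_of_hom (τ₀.comp g)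
  let q : TruncatedWittVector p 2 B₀ →ₐ[A] B₀ :=
    { coeffZero p B₀ with
      commutes' a := by
        refine (wittMap_coeff τ₀ (s a) 0).trans ?_
        rw [hs.coeff_zero]
        exact (RingHom.congr_fun h a).symm }
  let π'' : B →ₐ[A] B₀ := { π' with commutes' r := rfl }
  have hq : Function.Surjective q := coeffZero_surjective
  have hn : IsNilpotent (RingHom.ker (q : TruncatedWittVector p 2 B₀ →+* B₀)) :=
    isNilpotent_ker_coeffZero hk
  let t := Algebra.FormallySmooth.liftOfSurjective π'' q hq hn
  have ht (b : B) : q (t b) = π' b :=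
    Algebra.FormallySmooth.liftOfSurjective_apply π'' q hq hn b
  refine ⟨t, ⟨RingHom.ext fun a ↦ t.commutes a, RingHom.ext ht⟩, fun t' ⟨h1, h2⟩ ↦ ?_⟩
  let t'' : B →ₐ[A] TruncatedWittVector p 2 B₀ :=
    { t' with commutes' a := RingHom.congr_fun h1 a }
  have := Algebra.FormallyUnramified.ext' (q : TruncatedWittVector p 2 B₀ →+* B₀) hn t'' t
    fun b ↦ (RingHom.congr_fun h2 b).trans (ht b).symm
  exact RingHom.ext fun b ↦ AlgHom.congr_fun this b

end Sections

/-! ### Cobase change of a surjection. -/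

section Pushout

variable {R K A P : CommRingCat.{u}} {i : R ⟶ A} {j : R ⟶ K} {a : A ⟶ P} {b : K ⟶ P}

/-- The cobase change of a surjective homomorphism `j` is the quotient by the image of `ker j`. -/
theorem surjective_and_ker_le_of_isPushout (h : IsPushout i j a b)
    (hj : Function.Surjective j.hom) :
    Function.Surjective a.hom ∧ RingHom.ker a.hom ≤ (RingHom.ker j.hom).map i.hom := by
  let J := (RingHom.ker j.hom).map i.hom
  let q : A ⟶ CommRingCat.of (A ⧸ J) := CommRingCat.ofHom (Ideal.Quotient.mk J)
  have hq : ∀ r, j.hom r = 0 → q.hom (i.hom r) = 0 := fun r hr ↦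
    Ideal.Quotient.eq_zero_iff_mem.2 (Ideal.mem_map_of_mem i.hom hr)
  let e := RingHom.quotientKerEquivOfSurjective hj
  let c : K ⟶ CommRingCat.of (A ⧸ J) := CommRingCat.ofHom
    ((Ideal.Quotient.lift (RingHom.ker j.hom) (q.hom.comp i.hom) hq).comp e.symm.toRingHom)
  have hc : i ≫ q = j ≫ c := by
    ext r
    have : e.symm (j.hom r) = Ideal.Quotient.mk _ r :=
      e.injective (by rw [e.apply_symm_apply]; rfl)
    refine Eq.symm ((congrArg (Ideal.Quotient.lift (RingHom.ker j.hom) (q.hom.comp i.hom) hq)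
      this).trans ?_)
    rfl
  have ha : ∀ x ∈ J, a.hom x = 0 := by
    intro x hx
    refine RingHom.mem_ker.1 ((Ideal.map_le_iff_le_comap.2 fun r hr ↦ ?_ : J ≤ RingHom.ker a.hom) hx)
    have := ConcreteCategory.congr_hom h.w r
    refine this.trans ((congrArg b.hom (RingHom.mem_ker.1 hr)).trans (map_zero b.hom))
  let l : CommRingCat.of (A ⧸ J) ⟶ P := CommRingCat.ofHom (Ideal.Quotient.lift J a.hom ha)
  have hl : q ≫ l = a := by ext x; rfl
  -- The induced map `P → A / J` is compatible with the projections from `A`, which bounds the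
  -- kernel of `a`; that it is a section of `A / J → P` gives surjectivity of `a`.
  have hd : h.desc q c hc ≫ l = 𝟙 P := by
    refine h.hom_ext ?_ ?_
    · rw [h.inl_desc_assoc, hl, Category.comp_id]
    · rw [h.inr_desc_assoc, Category.comp_id]
      have hj' : Epi j := ConcreteCategory.epi_of_surjective _ hj
      rw [← cancel_epi j, ← reassoc_of% hc, hl, h.w]
  constructor
  · intro y
    obtain ⟨x, hx⟩ := Ideal.Quotient.mk_surjective ((h.desc q c hc).hom y)
    refine ⟨x, ?_⟩
    have := ConcreteCategory.congr_hom hd y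
    refine Eq.trans ?_ this
    exact congrArg l.hom hx
  · intro x hx
    rw [← Ideal.Quotient.eq_zero_iff_mem]
    have := ConcreteCategory.congr_hom (h.inl_desc q c hc) x
    refine this.symm.trans ((congrArg (h.desc q c hc).hom (RingHom.mem_ker.1 hx)).trans
      (map_zero _))

end Pushout

/-! ### Affine open subsets of `X` and the reduction map. -/

section Geometry

variable {p : ℕ} [hp : Fact p.Prime] {k : Type u} [Field k] [CharP k p]
  {X : Scheme.{u}} (f : X ⟶ Spec (CommRingCat.of (W₂ p k)))

theorem imageOpens_preimage (V : X.Opens) : imageOpens f (incl f ⁻¹ᵁ V) = V :=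
  Opens.ext (Set.image_preimage_eq _ (incl_isHomeomorph f).surjective)

theorem preimage_imageOpens (U : (reduction f).Opens) : incl f ⁻¹ᵁ imageOpens f U = U :=
  Opens.ext (Set.preimage_image_eq _ (incl_isHomeomorph f).injective)

/-- The open subsets of `X₀` that are affine in `X` form a basis. -/
theorem exists_affine_le {U : (reduction f).Opens} {x : reduction f} (hx : x ∈ U) :
    ∃ W : (reduction f).Opens, IsAffineOpen (imageOpens f W) ∧ x ∈ W ∧ W ≤ U := by
  obtain ⟨V, hV, hxV, hVU⟩ := exists_isAffineOpen_mem_and_subset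
    (x := incl f x) (U := imageOpens f U) ⟨x, hx, rfl⟩
  refine ⟨incl f ⁻¹ᵁ V, by rwa [imageOpens_preimage], hxV, ?_⟩
  rw [← preimage_imageOpens f U]
  exact fun y hy ↦ hVU hy

/-- Over affine opens, functions on a fibre product form the pushout of the rings of functions. It
makes `redMap` surjective with kernel generated by that of `W₂(k) → k`. -/
theorem isPushout_redMap {W : (reduction f).Opens} (hW : IsAffineOpen (imageOpens f W)) :
    IsPushout (scalars f (imageOpens f W)) (CommRingCat.ofHom (residue p k)) (redMap f W)
      (scalars (redStr f) W) := by
  have hUY : W = incl f ⁻¹ᵁ imageOpens f W ⊓ redStr f ⁻¹ᵁ ⊤ := by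
    rw [preimage_imageOpens]; exact (inf_top_eq _).symm
  have h := (isIso_pushoutSection_iff (IsPullback.of_hasPullback f
    (Spec.map (CommRingCat.ofHom (residue p k)))) (US := ⊤) (UT := ⊤) (UX := imageOpens f W)
    (UY := W) le_top le_top hUY).1 (isIso_pushoutSection_of_isAffineOpen _ _ _ _
      (isAffineOpen_top _) (isAffineOpen_top _) hW)
  refine h.of_iso (Scheme.ΓSpecIso _) (Iso.refl _) (Scheme.ΓSpecIso _) (Iso.refl _) ?_ ?_ ?_ ?_
  · simp [scalars, Scheme.Hom.appLE]
  · exact (Scheme.Hom.appLE_eq_app _).symm ▸ (by simp)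
  · simp [redMap]
  · simp [scalars, Scheme.Hom.appLE]

theorem redMap_surjective {W : (reduction f).Opens} (hW : IsAffineOpen (imageOpens f W)) :
    Function.Surjective (redMap f W) :=
  (surjective_and_ker_le_of_isPushout (isPushout_redMap f hW) residue_surjective).1

theorem ker_redMap_le {W : (reduction f).Opens} (hW : IsAffineOpen (imageOpens f W)) :
    RingHom.ker (redMap f W).hom ≤
      (RingHom.ker (residue p k)).map (scalars f (imageOpens f W)).hom :=
  (surjective_and_ker_le_of_isPushout (isPushout_redMap f hW) residue_surjective).2

omit [CharP k p] in
theorem formallySmooth_scalars [Smooth f] {V : X.Opens} (hV : IsAffineOpen V) :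
    (scalars f V).hom.FormallySmooth := by
  have h := (f.smooth_appLE (isAffineOpen_top _) hV le_top).formallySmooth
  have e : scalars f V = (Scheme.ΓSpecIso _).inv ≫ f.appLE ⊤ V le_top := by
    simp [scalars, Scheme.Hom.appLE]
  rw [e, CommRingCat.hom_comp]
  exact (RingHom.FormallySmooth.of_bijective
    (ConcreteCategory.bijective_of_isIso (Scheme.ΓSpecIso _).inv)).comp h

/-- The identity of `X` is étale, and the restriction between two affine opens is one of the ring
maps it induces. The smaller one need not be a basic open of the larger. -/
theorem formallyEtale_resMap {U V : ((reduction f).Opens)ᵒᵖ} (h : U ⟶ V)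
    (hU : IsAffineOpen (imageOpens f U.unop)) (hV : IsAffineOpen (imageOpens f V.unop)) :
    (resMap f h).hom.FormallyEtale := by
  have := ((𝟙 X : X ⟶ X).etale_appLE hU hV (imageOpens_mono f h.unop.le))
  have e : (𝟙 X : X ⟶ X).appLE _ _ (imageOpens_mono f h.unop.le) = resMap f h := by
    exact Category.id_comp _
  rw [e] at this
  algebraize [(resMap f h).hom]
  exact RingHom.formallyEtale_algebraMap.2 inferInstance

theorem exists_isWittLift_scalars [Smooth f] {U : (reduction f).Opens}
    (hU : IsAffineOpen (imageOpens f U)) :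
    ∃ s, IsWittLift (scalars f (imageOpens f U)).hom (redMap f U).hom
      (scalars (redStr f) U).hom s :=
  exists_isWittLift (formallySmooth_scalars f hU) (redMap_scalars f U)

end Geometry

/-! ### Sections of sheaves of modules on a basis of open subsets. -/

section Restriction

variable {Y : Scheme.{u}} (N : Y.Modules)

/-- Restriction of sections of a sheaf of modules. -/
def res {U V : Y.Opens} (h : V ≤ U) : Γ(N, U) →+ Γ(N, V) :=
  (N.presheaf.map (homOfLE h).op).hom

variable {N}

@[simp]
theorem res_refl {U : Y.Opens} (h : U ≤ U) (n : Γ(N, U)) : res N h n = n :=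
  ConcreteCategory.congr_hom (N.presheaf.map_id _) n

@[simp]
theorem res_res {U V W : Y.Opens} (h : V ≤ U) (h' : W ≤ V) (n : Γ(N, U)) :
    res N h' (res N h n) = res N (h'.trans h) n :=
  map_map_apply N _ _ _ n

theorem res_smul {U V : Y.Opens} (h : V ≤ U) (r : Γ(Y, U)) (n : Γ(N, U)) :
    res N h (r • n) = Y.presheaf.map (homOfLE h).op r • res N h n :=
  Scheme.Modules.map_smul ..

theorem app_res {M N : Y.Modules} (φ : M ⟶ N) {U V : Y.Opens} (h : V ≤ U) (m : Γ(M, U)) :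
    φ.app V (res M h m) = res N h (φ.app U m) :=
  ConcreteCategory.congr_hom (φ.mapPresheaf.naturality (homOfLE h).op) m

theorem eq_of_cover {ι : Type*} {U : Y.Opens} {V : ι → Y.Opens} (hV : ∀ i, V i ≤ U)
    (hcov : ∀ x ∈ U, ∃ i, x ∈ V i) {n n' : Γ(N, U)}
    (h : ∀ i, res N (hV i) n = res N (hV i) n') : n = n' := by
  let F : TopCat.Sheaf AddCommGrpCat.{u} Y := ⟨N.presheaf, N.isSheaf⟩
  exact F.eq_of_locally_eq' V U (fun i ↦ homOfLE (hV i))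
    (fun x hx ↦ Opens.mem_iSup.2 (hcov x hx)) n n' h

theorem exists_of_cover {ι : Type u} {U : Y.Opens} {V : ι → Y.Opens} (hV : ∀ i, V i ≤ U)
    (hcov : ∀ x ∈ U, ∃ i, x ∈ V i) (t : ∀ i, Γ(N, V i))
    (ht : ∀ i j, res N (inf_le_left : V i ⊓ V j ≤ V i) (t i) =
      res N (inf_le_right : V i ⊓ V j ≤ V j) (t j)) :
    ∃ n : Γ(N, U), ∀ i, res N (hV i) n = t i := by
  let F : TopCat.Sheaf AddCommGrpCat.{u} Y := ⟨N.presheaf, N.isSheaf⟩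
  obtain ⟨n, hn, -⟩ := F.existsUnique_gluing' V U (fun i ↦ homOfLE (hV i))
    (fun x hx ↦ Opens.mem_iSup.2 (hcov x hx)) t ht
  exact ⟨n, hn⟩

/-- A property of open subsets that defines a basis of the topology. -/
def IsBasisProp (B : Y.Opens → Prop) : Prop :=
  ∀ (U : Y.Opens), ∀ x ∈ U, ∃ W, B W ∧ x ∈ W ∧ W ≤ U

theorem eq_of_basis {B : Y.Opens → Prop} (hB : IsBasisProp B) {U : Y.Opens} {n n' : Γ(N, U)}
    (h : ∀ W (_ : B W) (hW : W ≤ U), res N hW n = res N hW n') : n = n' :=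
  eq_of_cover (ι := {W // B W ∧ W ≤ U}) (V := fun W ↦ W.1) (fun W ↦ W.2.2)
    (fun x hx ↦ let ⟨W, hW, hxW, hWU⟩ := hB U x hx; ⟨⟨W, hW, hWU⟩, hxW⟩)
    fun W ↦ h W.1 W.2.1 W.2.2

theorem exists_of_basis {B : Y.Opens → Prop} (hB : IsBasisProp B) {U : Y.Opens}
    (t : ∀ W, B W → W ≤ U → Γ(N, W))
    (ht : ∀ W W' (hW : B W) (hW' : B W') (hWU : W ≤ U) (h : W' ≤ W),
      res N h (t W hW hWU) = t W' hW' (h.trans hWU)) :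
    ∃ n : Γ(N, U), ∀ W (hW : B W) (hWU : W ≤ U), res N hWU n = t W hW hWU := by
  obtain ⟨n, hn⟩ := exists_of_cover (N := N) (ι := {W // B W ∧ W ≤ U}) (V := fun W ↦ W.1)
    (fun W ↦ W.2.2) (fun x hx ↦ let ⟨W, hW, hxW, hWU⟩ := hB U x hx; ⟨⟨W, hW, hWU⟩, hxW⟩)
    (fun W ↦ t W.1 W.2.1 W.2.2) (fun i j ↦ by
      -- The basis need not be stable under intersection: agreement on an overlap is tested on the
      -- basic opens inside it.
      refine eq_of_basis hB fun W hW hWij ↦ ?_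
      rw [res_res, res_res, ht _ _ i.2.1 hW, ht _ _ j.2.1 hW])
  exact ⟨n, fun W hW hWU ↦ hn ⟨W, hW, hWU⟩⟩

end Restriction

/-! ### The sheaf `j_* j^* N` for an open subset. -/

section Extension

variable {Y : Scheme.{u}} (N : Y.Modules) (U : Y.Opens)

/-- The sheaf `V ↦ Γ(N, U ∩ V)`, that is `j_* j^* N` for the inclusion `j` of `U`. -/
abbrev extend : Y.Modules := (Scheme.Modules.pushforward U.ι).obj (N.restrict U.ι)

/-- The open subset `U ∩ V`. -/
abbrev cut (V : Y.Opens) : Y.Opens := U.ι ''ᵁ (U.ι ⁻¹ᵁ V)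

theorem cut_eq (V : Y.Opens) : cut U V = U ⊓ V := by
  rw [cut, Scheme.Hom.image_preimage_eq_opensRange_inf, Scheme.Opens.opensRange_ι]

/-- Sections of `extend N U` over `V` are sections of `N` over `U ∩ V`. -/
def ofExtend (V : Y.Opens) : Γ(extend N U, V) ≃+ Γ(N, cut U V) := AddEquiv.refl _

theorem ofExtend_res {V W : Y.Opens} (h : W ≤ V) (h' : cut U W ≤ cut U V) (n : Γ(extend N U, V)) :
    ofExtend N U W (res _ h n) = res N h' (ofExtend N U V n) := rfl

/-- The underlying groups coincide by definition, but scalars reach `U ∩ V` through the open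
subscheme `U`; the composite is plain restriction. -/
theorem ofExtend_smul (V : Y.Opens) (h : cut U V ≤ V) (r : Γ(Y, V)) (n : Γ(extend N U, V)) :
    ofExtend N U V (r • n) = Y.presheaf.map (homOfLE h).op r • ofExtend N U V n := by
  refine Eq.trans (b := (U.ι.appIso (U.ι ⁻¹ᵁ V)).inv ((U.ι.app V) r) • ofExtend N U V n) rfl ?_
  congr 1
  have := U.ι.app_appIso_inv V
  exact ConcreteCategory.congr_hom this r

end Extension

/-! ### Maps out of an attached sheaf. -/

section Sheafify

variable {Y : Scheme.{u}} {M : Y.PresheafOfModules} {N : Y.Modules}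

variable (N) in
/-- The presheaf of modules underlying a sheaf of modules. -/
abbrev asPresheaf : Y.PresheafOfModules :=
  (SheafOfModules.forget _ ⋙ PresheafOfModules.restrictScalars (𝟙 Y.ringCatSheaf.obj)).obj N

variable (M N) in
/-- The universal property of the sheaf attached to a presheaf of modules. -/
def sheafifyHomEquiv : (sheafify M ⟶ N) ≃ (M ⟶ asPresheaf N) :=
  (PresheafOfModules.sheafificationAdjunction (𝟙 Y.ringCatSheaf.obj)).homEquiv M N

theorem app_toSheafify (h : sheafify M ⟶ N) (U : Y.Opens) (m : M.obj (op U)) :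
    h.app U (toSheafify M U m) = ((sheafifyHomEquiv M N h).app (op U)).hom m :=
  congrArg (fun φ ↦ (φ.app (op U)).hom m) (Adjunction.homEquiv_unit
    (PresheafOfModules.sheafificationAdjunction (𝟙 Y.ringCatSheaf.obj)) M N h).symm

theorem app_sheafifyHomEquiv_symm (h : M ⟶ asPresheaf N) (U : Y.Opens) (m : M.obj (op U)) :
    ((sheafifyHomEquiv M N).symm h).app U (toSheafify M U m) = (h.app (op U)).hom m :=
  (app_toSheafify _ U m).trans
    (congrArg (fun φ ↦ (φ.app (op U)).hom m) ((sheafifyHomEquiv M N).apply_symm_apply h))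

end Sheafify

/-! ### The universal property of `F^* Ω¹`. -/

section Frobenius

variable {p : ℕ} [hp : Fact p.Prime] {k : Type u} [Field k] [CharP k p]
  {Y : Scheme.{u}} (g : Y ⟶ Spec (CommRingCat.of k))

theorem app_frobPull {M N : Y.Modules}
    (h : (Scheme.Modules.pullback (absFrobenius (p := p) g)).obj M ⟶ N) (U : Y.Opens) (m : Γ(M, U)) :
    h.app U (frobPull g M U m) =
      (((Scheme.Modules.pullbackPushforwardAdjunction (absFrobenius (p := p) g)).homEquiv M N
        h).app U) m := by
  rw [Adjunction.homEquiv_unit]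
  rfl

/-- Both sheafification and the presheaf of differentials have a universal property, so maps out of
`Ω¹` are determined by exact differentials. -/
theorem kaehler_hom_ext {S : CommRingCat.{u}} {Y : Scheme.{u}} (g : Y ⟶ Spec S) {N : Y.Modules}
    {h h' : kaehler g ⟶ N}
    (H : ∀ U s, h.app U (kaehlerD g U s) = h'.app U (kaehlerD g U s)) : h = h' := by
  refine (sheafifyHomEquiv _ N).injective ?_
  refine (PresheafOfModules.DifferentialsConstruction.isUniversal' (scalarsHom g)).postcomp_injective
    _ _ ?_
  ext U s
  exact (app_toSheafify h _ _).symm.trans ((H U.unop s).trans (app_toSheafify h' _ _))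

theorem frobKaehler_hom_ext {N : Y.Modules} {h h' : frobKaehler (p := p) g ⟶ N}
    (H : ∀ U s, h.app U (frobPull g _ U (kaehlerD g U s)) =
      h'.app U (frobPull g _ U (kaehlerD g U s))) : h = h' := by
  refine ((Scheme.Modules.pullbackPushforwardAdjunction (absFrobenius (p := p) g)).homEquiv _
    N).injective (kaehler_hom_ext g fun U s ↦ ?_)
  rw [← app_frobPull, ← app_frobPull]
  exact H U s

/-- Derivations of `𝒪_Y` over `S` into `N` factor through `Ω¹`. -/
theorem exists_kaehler_hom {S : CommRingCat.{u}} {Y : Scheme.{u}} (g : Y ⟶ Spec S) {N : Y.Modules}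
    (D : ∀ U : Y.Opens, Γ(Y, U) →+ Γ(N, U))
    (hmul : ∀ U a b, D U (a * b) = a • D U b + b • D U a)
    (hscalar : ∀ U r, D U (scalars g U r) = 0)
    (hres : ∀ (U V : Y.Opens) (h : V ≤ U) a, D V (Y.presheaf.map (homOfLE h).op a) = res N h (D U a)) :
    ∃ h : kaehler g ⟶ N, ∀ U s, h.app U (kaehlerD g U s) = D U s := by
  let d : PresheafOfModules.Derivation'
      (show PresheafOfModules (Y.presheaf ⋙ forget₂ _ _) from asPresheaf N) (scalarsHom g) :=
    { d {U} := D U.unop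
      d_mul {U} a b := hmul U.unop a b
      d_map {U V} h a := hres _ _ h.unop.le a
      d_app {U} r := hscalar U.unop r }
  let u := PresheafOfModules.DifferentialsConstruction.isUniversal' (scalarsHom g)
  refine ⟨(sheafifyHomEquiv _ N).symm (u.desc d), fun U s ↦
    (app_sheafifyHomEquiv_symm _ U _).trans ?_⟩
  exact PresheafOfModules.Derivation.congr_d (u.fac d) (X := op U) s

theorem exists_frobKaehler_hom {N : Y.Modules} (D : ∀ U : Y.Opens, Γ(Y, U) →+ Γ(N, U))
    (hmul : ∀ U a b, D U (a * b) = a ^ p • D U b + b ^ p • D U a)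
    (hscalar : ∀ U r, D U (scalars g U r) = 0)
    (hres : ∀ (U V : Y.Opens) (h : V ≤ U) a, D V (Y.presheaf.map (homOfLE h).op a) = res N h (D U a)) :
    ∃ h : frobKaehler (p := p) g ⟶ N, ∀ U s, h.app U (frobPull g _ U (kaehlerD g U s)) = D U s := by
  -- Frobenius is the identity on points and acts on scalars by `p`-th powers, so the twisted
  -- Leibniz rule for `N` is the ordinary one for `F_* N`.
  obtain ⟨h, hh⟩ := exists_kaehler_hom g
    (N := (Scheme.Modules.pushforward (absFrobenius (p := p) g)).obj N) D hmul hscalar hres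
  refine ⟨((Scheme.Modules.pullbackPushforwardAdjunction (absFrobenius (p := p) g)).homEquiv _
    N).symm h, fun U s ↦ ?_⟩
  rw [app_frobPull, Equiv.apply_symm_apply]
  exact hh U s

end Frobenius

/-! ### Local injectivity and local surjectivity of sheafification. -/

section Sheafify

variable {Y : Scheme.{u}} (M : Y.PresheafOfModules)

theorem exists_map_eq_zero_of_toSheafify_eq_zero {U : Y.Opens} {m : M.obj (op U)}
    (h : toSheafify M U m = 0) {x : Y} (hx : x ∈ U) :
    ∃ (V : Y.Opens) (i : V ⟶ U), x ∈ V ∧ M.map i.op m = 0 := by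
  have := Presheaf.equalizerSieve_mem (Opens.grothendieckTopology Y)
    (CategoryTheory.toSheafify (Opens.grothendieckTopology Y) M.presheaf) (X := op U) m 0
    (Eq.trans h (map_zero (toSheafify M U)).symm)
  obtain ⟨V, i, hi, hxV⟩ := this x hx
  exact ⟨V, i, hxV, hi.trans (map_zero (M.map i.op).hom)⟩

theorem exists_toSheafify_eq_res {U : Y.Opens} (s : Γ(sheafify M, U)) {x : Y} (hx : x ∈ U) :
    ∃ (V : Y.Opens) (i : V ≤ U) (m : M.obj (op V)), x ∈ V ∧
      toSheafify M V m = res (sheafify M) i s := by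
  have := Presheaf.imageSieve_mem (Opens.grothendieckTopology Y)
    (CategoryTheory.toSheafify (Opens.grothendieckTopology Y) M.presheaf) (U := op U) s
  obtain ⟨V, i, ⟨m, hm⟩, hxV⟩ := this x hx
  exact ⟨V, i.le, m, hxV, hm⟩

end Sheafify

/-! ### A criterion for short exactness of abelian sheaves. -/

section ShortExact

variable {Y : Scheme.{u}}

/-- A short complex of abelian sheaves is short exact if it is left exact on sections and its last
map is locally surjective. -/
theorem shortExact_of_sections
    {S : ShortComplex (Sheaf (Opens.grothendieckTopology Y) AddCommGrpCat.{u})}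
    (hinj : ∀ U : Y.Opens, Function.Injective (S.f.hom.app (op U)))
    (hex : ∀ (U : Y.Opens) (s : S.X₂.obj.obj (op U)), S.g.hom.app (op U) s = 0 →
      ∃ t, S.f.hom.app (op U) t = s)
    (hsurj : ∀ (U : Y.Opens) (s : S.X₃.obj.obj (op U)), ∀ x ∈ U, ∃ (V : Y.Opens) (i : V ⟶ U),
      x ∈ V ∧ ∃ t, S.g.hom.app (op V) t = S.X₃.obj.map i.op s) : S.ShortExact := by
  have hmono : Mono S.f := by
    have : Mono ((sheafToPresheaf _ _).map S.f) :=
      (NatTrans.mono_iff_mono_app _).2 fun U ↦ (AddCommGrpCat.mono_iff_injective _).2 (hinj U.unop)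
    exact (sheafToPresheaf _ _).mono_of_mono_map this
  have hepi : Epi S.g := by
    rw [← Sheaf.isLocallySurjective_iff_epi']
    refine ⟨fun {U} s x hx ↦ ?_⟩
    obtain ⟨V, i, hxV, ht⟩ := hsurj U s x hx
    exact ⟨V, i, ht, hxV⟩
  refine ShortComplex.ShortExact.mk' ?_ hmono hepi
  refine S.exact_of_f_is_kernel (Limits.KernelFork.IsLimit.ofι' _ _ fun {A} a ha ↦ ?_)
  have hz (U : (Opens Y)ᵒᵖ) (s : A.obj.obj U) : S.g.hom.app U (a.hom.app U s) = 0 :=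
    congrArg (fun φ : A ⟶ S.X₃ ↦ φ.hom.app U s) ha
  -- The preimages are unique by `hinj`, so the chosen ones are automatically additive and
  -- compatible with restriction.
  choose l hl using fun (U : (Opens Y)ᵒᵖ) (s : A.obj.obj U) ↦ hex U.unop _ (hz U s)
  refine ⟨⟨{ app U := AddCommGrpCat.ofHom (AddMonoidHom.mk' (l U) fun s t ↦ hinj U.unop ?_)
             naturality U V i := ?_ }⟩, ?_⟩
  · exact (hl U _).trans ((map_add (a.hom.app U).hom s t).trans
      ((congrArg₂ _ (hl U s).symm (hl U t).symm).trans (map_add (S.f.hom.app U).hom _ _).symm))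
  · ext s
    refine hinj V.unop ?_
    refine (hl V _).trans ?_
    refine Eq.trans ?_ (NatTrans.naturality_apply S.f.hom i (l U s)).symm
    refine (NatTrans.naturality_apply a.hom i s).trans ?_
    exact congrArg (S.X₂.obj.map i) (hl U s).symm
  · refine Sheaf.hom_ext (NatTrans.ext (funext fun U ↦ ?_))
    ext s
    exact hl U s

end ShortExact

/-! ### Homomorphisms over an open subset as morphisms into `j_* j^* N`. -/

section HomOn

variable {Y : Scheme.{u}} {M N : Y.Modules}

/-- A morphism of sheaves of modules from its components. -/
def modulesHomMk (φ : ∀ U : Y.Opens, Γ(M, U) →ₗ[Γ(Y, U)] Γ(N, U))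
    (h : ∀ (U V : Y.Opens) (i : V ≤ U) m, φ V (res M i m) = res N i (φ U m)) : M ⟶ N :=
  show SheafOfModules.Hom M N from
  { val :=
    { app U := ModuleCat.ofHom (φ U.unop)
      naturality {U V} i := by
        refine ModuleCat.hom_ext (LinearMap.ext fun m ↦ ?_)
        exact h _ _ i.unop.le m } }

theorem homOn_res {U : Y.Opens} (φ : homOn M N U) {V W : Y.Opens} (hV : V ≤ U) (hW : W ≤ V)
    (m : Γ(M, V)) : φ.1 ⟨W, hW.trans hV⟩ (res M hW m) = res N hW (φ.1 ⟨V, hV⟩ m) :=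
  φ.2 ⟨V, hV⟩ ⟨W, hW.trans hV⟩ (homOfLE hW) m

theorem cut_le_left (U V : Y.Opens) : cut U V ≤ U := (cut_eq U V).le.trans inf_le_left

theorem cut_le_right (U V : Y.Opens) : cut U V ≤ V := (cut_eq U V).le.trans inf_le_right

theorem cut_mono (U : Y.Opens) {V W : Y.Opens} (h : W ≤ V) : cut U W ≤ cut U V := by
  rw [cut_eq, cut_eq]; exact inf_le_inf_left _ h

theorem le_cut {U V : Y.Opens} (h : V ≤ U) : V ≤ cut U V := by
  rw [cut_eq]; exact le_inf h le_rfl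

/-- The component of `toExtend` over `V`. -/
def toExtendApp {U : Y.Opens} (φ : homOn M N U) (V : Y.Opens) :
    Γ(M, V) →ₗ[Γ(Y, V)] Γ(extend N U, V) where
  toFun m := (ofExtend N U V).symm (φ.1 ⟨cut U V, cut_le_left U V⟩ (res M (cut_le_right U V) m))
  map_add' m m' := by rw [map_add, map_add, map_add]
  map_smul' r m := by
    refine (ofExtend N U V).injective ?_
    refine ((ofExtend N U V).apply_symm_apply _).trans ?_
    refine Eq.trans ?_ (ofExtend_smul N U V (cut_le_right U V) r _).symm
    refine Eq.trans ?_ (congrArg _ ((ofExtend N U V).apply_symm_apply _).symm)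
    rw [res_smul, map_smul]

theorem ofExtend_toExtendApp {U : Y.Opens} (φ : homOn M N U) (V : Y.Opens) (m : Γ(M, V)) :
    ofExtend N U V (toExtendApp φ V m) =
      φ.1 ⟨cut U V, cut_le_left U V⟩ (res M (cut_le_right U V) m) :=
  (ofExtend N U V).apply_symm_apply _

/-- Homomorphisms `M|_U → N|_U` as homomorphisms `M → j_* j^* N`. -/
def toExtend {U : Y.Opens} (φ : homOn M N U) : M ⟶ extend N U :=
  modulesHomMk (toExtendApp φ) fun V W i m ↦ by
    refine (ofExtend N U W).injective ?_
    rw [ofExtend_res N U i (cut_mono U i), ofExtend_toExtendApp, ofExtend_toExtendApp,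
      ← homOn_res φ (cut_le_left U V) (cut_mono U i), res_res, res_res]

theorem toExtend_app {U : Y.Opens} (φ : homOn M N U) (V : Y.Opens) (m : Γ(M, V)) :
    ofExtend N U V ((toExtend φ).app V m) =
      φ.1 ⟨cut U V, cut_le_left U V⟩ (res M (cut_le_right U V) m) :=
  ofExtend_toExtendApp φ V m

/-- A homomorphism `M → j_* j^* N` restricts to a homomorphism `M|_U → N|_U`. -/
def ofExtendHom {U : Y.Opens} (h : M ⟶ extend N U) : homOn M N U :=
  ⟨fun V ↦
    -- For `V ≤ U` the opens `cut U V` and `V` are equal, but not by definition; the restriction map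
    -- identifies the sections.
    { toFun m := res N (le_cut V.2) (ofExtend N U V.1 (h.app V.1 m))
      map_add' m m' := by rw [map_add, map_add, map_add]
      map_smul' r m := by
        rw [h.app_smul, ofExtend_smul _ _ _ (cut_le_right U V.1), res_smul, RingHom.id_apply]
        congr 1
        refine (ConcreteCategory.congr_hom (Y.presheaf.map_comp (homOfLE (cut_le_right U V.1)).op
          (homOfLE (le_cut V.2)).op) r).symm.trans ?_
        exact ConcreteCategory.congr_hom (Y.presheaf.map_id _) r }, fun V W i m ↦ by
      change res N _ (ofExtend N U W.1 (h.app W.1 (res M i.le m))) = res N i.le (res N _ _)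
      rw [app_res, ofExtend_res N U i.le (cut_mono U i.le), res_res, res_res]⟩

theorem ofExtendHom_apply {U : Y.Opens} (h : M ⟶ extend N U) {V : Y.Opens} (hV : V ≤ U)
    (m : Γ(M, V)) :
    (ofExtendHom h).1 ⟨V, hV⟩ m = res N (le_cut hV) (ofExtend N U V (h.app V m)) := rfl

/-- Transfers uniqueness statements for global morphisms, such as `frobKaehler_hom_ext`, to
homomorphisms defined only over `U`. -/
theorem toExtend_injective {U : Y.Opens} : Function.Injective (toExtend (M := M) (N := N) (U := U)) := by
  intro φ ψ h
  refine Subtype.ext (funext fun V ↦ LinearMap.ext fun m ↦ ?_)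
  have := congrArg (fun χ : M ⟶ extend N U ↦ res N (le_cut V.2) (ofExtend N U V.1 (χ.app V.1 m))) h
  simp only [toExtend_app] at this
  rw [← homOn_res φ (cut_le_left U V.1) (le_cut V.2), ← homOn_res ψ (cut_le_left U V.1) (le_cut V.2),
    res_res, res_refl] at this
  exact this

end HomOn

/-! ### Locally split extensions, their classes and connecting maps. -/

section HomSequence

variable {Y : Scheme.{u}} {S : ShortComplex Y.Modules}

/-- Left exactness is general. For surjectivity, a local section `σ` of `S.g` lifts a homomorphism
`φ` to `σ ∘ φ`. -/
theorem homSequence_shortExact (hinj : ∀ U, Function.Injective (S.f.app U))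
    (hex : ∀ (U : Y.Opens) (m : Γ(S.X₂, U)), S.g.app U m = 0 → ∃ n, S.f.app U n = m)
    (hsec : ∀ x : Y, ∃ (U : Y.Opens) (σ : homOn S.X₃ S.X₂ U), x ∈ U ∧
      ∀ V m, S.g.app V.1 (σ.1 V m) = m) : (homSequence S).ShortExact := by
  refine shortExact_of_sections ?_ ?_ ?_
  · intro U φ ψ h
    refine Subtype.ext (funext fun V ↦ LinearMap.ext fun m ↦ hinj V.1 ?_)
    exact congrArg (fun χ : homOn S.X₃ S.X₂ U ↦ χ.1 V m) h
  · intro U φ hφ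
    have hz (V : {V : Y.Opens // V ≤ U}) (m : Γ(S.X₃, V.1)) :
        S.g.app V.1 ((show homOn S.X₃ S.X₂ U from φ).1 V m) = 0 :=
      congrArg (fun χ : homOn S.X₃ S.X₃ U ↦ χ.1 V m) hφ
    choose l hl using fun V m ↦ hex _ _ (hz V m)
    refine ⟨(⟨fun V ↦
      { toFun := l V
        map_add' m m' := hinj V.1 (by rw [map_add, hl, hl, hl, map_add])
        map_smul' r m := hinj V.1 (by
          rw [S.f.app_smul, hl, hl, map_smul, RingHom.id_apply]) }, fun V W i m ↦ hinj W.1 ?_⟩ :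
            homOn S.X₃ S.X₁ U), ?_⟩
    · refine (hl W _).trans ?_
      refine Eq.trans ?_ (app_res S.f i.le (l V m)).symm
      rw [hl]
      exact (show homOn S.X₃ S.X₂ U from φ).2 V W i m
    · exact Subtype.ext (funext fun V ↦ LinearMap.ext fun m ↦ hl V m)
  · intro U φ x hx
    obtain ⟨U', σ, hxU', hσ⟩ := hsec x
    refine ⟨U ⊓ U', homOfLE inf_le_left, ⟨hx, hxU'⟩, ?_⟩
    let φ' : homOn S.X₃ S.X₃ U := φ
    refine ⟨(⟨fun V ↦ σ.1 ⟨V.1, V.2.trans inf_le_right⟩ ∘ₗ φ'.1 ⟨V.1, V.2.trans inf_le_left⟩,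
      fun V W i m ↦ ?_⟩ : homOn S.X₃ S.X₂ (U ⊓ U')), ?_⟩
    · refine Eq.trans (congrArg (σ.1 ⟨W.1, _⟩) (φ'.2 ⟨V.1, V.2.trans inf_le_left⟩
        ⟨W.1, W.2.trans inf_le_left⟩ i m)) ?_
      exact σ.2 ⟨V.1, V.2.trans inf_le_right⟩ ⟨W.1, W.2.trans inf_le_right⟩ i _
    · exact Subtype.ext (funext fun V ↦ LinearMap.ext fun m ↦ hσ ⟨V.1, _⟩ _)

theorem abelianSheaf_shortExact (hinj : ∀ U, Function.Injective (S.f.app U))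
    (hex : ∀ (U : Y.Opens) (m : Γ(S.X₂, U)), S.g.app U m = 0 → ∃ n, S.f.app U n = m)
    (hsec : ∀ x : Y, ∃ (U : Y.Opens) (σ : homOn S.X₃ S.X₂ U), x ∈ U ∧
      ∀ V m, S.g.app V.1 (σ.1 V m) = m) : (S.map (abelianSheaf Y)).ShortExact := by
  refine shortExact_of_sections hinj hex fun U s x hx ↦ ?_
  obtain ⟨U', σ, hxU', hσ⟩ := hsec x
  exact ⟨U ⊓ U', homOfLE inf_le_left, ⟨hx, hxU'⟩,
    σ.1 ⟨U ⊓ U', inf_le_right⟩ (res S.X₃ inf_le_left s), hσ ⟨U ⊓ U', inf_le_right⟩ _⟩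

/-- Evaluation at a global section, as a map from the sequence of sheaves of homomorphisms. -/
def evalSequence (S : ShortComplex Y.Modules) (ω : Γ(S.X₃, ⊤)) :
    homSequence S ⟶ S.map (abelianSheaf Y) where
  τ₁ := evalAt S.X₁ ω
  τ₂ := evalAt S.X₂ ω
  τ₃ := evalAt S.X₃ ω
  comm₁₂ := rfl
  comm₂₃ := rfl

/-- The connecting map of an extension is the cup product with the extension class. -/
theorem connecting_eq_cup_extensionClass (h : (S.map (abelianSheaf Y)).ShortExact)
    (h' : (homSequence S).ShortExact) (ω : Coh ((abelianSheaf Y).obj S.X₃) 0) :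
    connecting h 0 ω = cup ω (extensionClass S h') := by
  let s : Γ(S.X₃, ⊤) := globalSections _ ω
  -- Evaluation at `s` is a morphism of short exact sequences, so each extension class, composed
  -- with evaluation on its own side, gives the same element of `Ext¹`.
  have hnat := ShortComplex.ShortExact.extClass_naturality h' h (evalSequence S s)
  have hω : Sheaf.H.map (evalAt S.X₃ s) 0 ((globalSections _).symm (idSection S.X₃)) = ω := by
    refine (Sheaf.H.equiv₀_symm_naturality _ _ _).trans ?_
    refine (Equiv.symm_apply_eq (globalSections ((abelianSheaf Y).obj S.X₃)).toEquiv).2 ?_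
    exact res_refl (N := S.X₃) le_rfl s
  let e := (globalSections _).symm (idSection S.X₃)
  -- With `ω` written as the image of the identity section, the claim becomes an associativity of
  -- Yoneda products: evaluation moves from before the class to after it.
  have h₁ : connecting h 0 ω = (Sheaf.H.map (evalAt S.X₃ s) 0 e).comp h.extClass (zero_add 1) := by
    rw [hω]; rfl
  refine h₁.trans ((Abelian.Ext.comp_assoc e _ _ (add_zero 0) (zero_add 1) rfl).trans ?_)
  refine (congrArg (fun z ↦ e.comp z (zero_add 1)) hnat.symm).trans ?_
  exact (Abelian.Ext.comp_assoc e _ _ (zero_add 1) (add_zero 1) rfl).symm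

end HomSequence

/-! ### Restriction of functions. -/

section StructureSheaf

variable {Y : Scheme.{u}}

/-- Restriction of functions. -/
def sres {U V : Y.Opens} (h : V ≤ U) : Γ(Y, U) →+* Γ(Y, V) := (Y.presheaf.map (homOfLE h).op).hom

@[simp]
theorem sres_refl {U : Y.Opens} (h : U ≤ U) (s : Γ(Y, U)) : sres h s = s :=
  ConcreteCategory.congr_hom (Y.presheaf.map_id _) s

@[simp]
theorem sres_sres {U V W : Y.Opens} (h : V ≤ U) (h' : W ≤ V) (s : Γ(Y, U)) :
    sres h' (sres h s) = sres (h'.trans h) s :=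
  (ConcreteCategory.congr_hom (Y.presheaf.map_comp (homOfLE h).op (homOfLE h').op) s).symm

theorem res_smul_sres {N : Y.Modules} {U V : Y.Opens} (h : V ≤ U) (r : Γ(Y, U)) (n : Γ(N, U)) :
    res N h (r • n) = sres h r • res N h n := res_smul h r n

theorem sres_scalars {S : CommRingCat.{u}} (g : Y ⟶ Spec S) {U V : Y.Opens} (h : V ≤ U) (r : S) :
    sres h (scalars g U r) = scalars g V r :=
  ConcreteCategory.congr_hom (scalars_map g (homOfLE h).op) r

end StructureSheaf

/-! ### Descent of semilinear derivations from `X` to `X₀`. -/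

section Descent

variable {p : ℕ} [hp : Fact p.Prime] {k : Type u} [Field k] [CharP k p]
  {X : Scheme.{u}} (f : X ⟶ Spec (CommRingCat.of (W₂ p k)))

/-- The open subsets of `X₀` that are affine as open subsets of `X`. -/
abbrev IsAff (W : (reduction f).Opens) : Prop := IsAffineOpen (imageOpens f W)

theorem isBasisProp_isAff : IsBasisProp (IsAff f) := fun _ _ hx ↦ exists_affine_le f hx

theorem redMap_resMap {U V : (reduction f).Opens} (h : V ≤ U) (a : Γ(X, imageOpens f U)) :
    redMap f V (resMap f (homOfLE h).op a) = sres h (redMap f U a) :=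
  ConcreteCategory.congr_hom (resMap_redMap f (homOfLE h).op) a

variable {f}

section

variable {N : (reduction f).Modules} {W : (reduction f).Opens} (hW : IsAff f W)
  (e : Γ(X, imageOpens f W) →+ Γ(N, W))
  (hmul : ∀ a b, e (a * b) = redMap f W b ^ p • e a + redMap f W a ^ p • e b)
  (hscalar : ∀ r, e (scalars f (imageOpens f W) r) = 0)

include hW hmul hscalar in
theorem eq_zero_of_redMap_eq_zero {a : Γ(X, imageOpens f W)} (ha : redMap f W a = 0) : e a = 0 := by
  have hmem := ker_redMap_le f hW (RingHom.mem_ker.2 ha)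
  -- The induction carries both vanishings: in the Leibniz rule for `b * x` the term in `e b` has
  -- the factor `redMap x ^ p`.
  suffices h : e a = 0 ∧ redMap f W a = 0 from h.1
  refine Submodule.span_induction ?_ ?_ ?_ ?_ hmem
  · rintro _ ⟨r, hr, rfl⟩
    refine ⟨hscalar r, (redMap_scalars f W r).trans ?_⟩
    rw [RingHom.mem_ker.1 hr, map_zero]
  · exact ⟨map_zero e, map_zero (redMap f W).hom⟩
  · rintro x y - - ⟨hx, hx'⟩ ⟨hy, hy'⟩
    exact ⟨by rw [map_add, hx, hy, add_zero], by rw [map_add, hx', hy', add_zero]⟩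
  · rintro b x - ⟨hx, hx'⟩
    exact ⟨by rw [smul_eq_mul, hmul, hx, hx', smul_zero, zero_pow hp.out.ne_zero, zero_smul,
      add_zero], by rw [smul_eq_mul, map_mul, hx', mul_zero]⟩

include hW hmul hscalar in
/-- A Frobenius-semilinear derivation on `Γ(X, W)` that kills `W₂(k)` descends to `Γ(X₀, W)`. -/
theorem exists_descent : ∃ e₀ : Γ(reduction f, W) →+ Γ(N, W), ∀ a, e₀ (redMap f W a) = e a := by
  have hs := redMap_surjective f hW
  have key (a b) (h : redMap f W a = redMap f W b) : e a = e b := by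
    rw [← sub_eq_zero, ← map_sub]
    refine eq_zero_of_redMap_eq_zero hW e hmul hscalar ?_
    rw [map_sub, h, sub_self]
  refine ⟨AddMonoidHom.mk' (fun s ↦ e (Function.surjInv hs s)) fun s t ↦ ?_, fun a ↦
    key _ _ (Function.surjInv_eq hs _)⟩
  rw [← map_add]
  refine key _ _ ?_
  have hinv (s) : redMap f W (Function.surjInv hs s) = s := Function.surjInv_eq hs s
  rw [map_add, hinv, hinv, hinv]

end

/-- On opens that are affine in `X`, every function on `X₀` lifts to `X`, so differentials of
reductions suffice to test equality. -/
theorem homOn_frobKaehler_ext {N : (reduction f).Modules} {U : (reduction f).Opens}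
    {φ ψ : homOn (frobKaehler (p := p) (redStr f)) N U}
    (h : ∀ W (_ : IsAff f W) (hWU : W ≤ U) (x : Γ(X, imageOpens f W)),
      φ.1 ⟨W, hWU⟩ (frobPull (redStr f) _ W (kaehlerD (redStr f) W (redMap f W x))) =
        ψ.1 ⟨W, hWU⟩ (frobPull (redStr f) _ W (kaehlerD (redStr f) W (redMap f W x)))) : φ = ψ := by
  refine toExtend_injective (frobKaehler_hom_ext _ fun V s ↦ (ofExtend N U V).injective ?_)
  rw [toExtend_app, toExtend_app]
  refine eq_of_basis (isBasisProp_isAff f) fun W hW hWV ↦ ?_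
  rw [← homOn_res, ← homOn_res, res_res]
  obtain ⟨x, hx⟩ := redMap_surjective f hW (sres (hWV.trans (cut_le_right U V)) s)
  have hs : res (frobKaehler (p := p) (redStr f)) (hWV.trans (cut_le_right U V))
      (frobPull (redStr f) _ V (kaehlerD (redStr f) V s)) =
        frobPull (redStr f) _ W (kaehlerD (redStr f) W (redMap f W x)) := by
    rw [hx]
    refine Eq.trans (frobPull_map (redStr f) _ (homOfLE _) _).symm ?_
    exact congrArg (frobPull (redStr f) _ W) (kaehlerD_map (redStr f) (homOfLE _) s).symm
  rw [hs]
  exact h W hW _ x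

/-- Compatible Frobenius-semilinear derivations on the affine open subsets of `U` define a
homomorphism on `F^* Ω¹` over `U`. -/
theorem exists_homOn_frobKaehler {N : (reduction f).Modules} {U : (reduction f).Opens}
    (e : ∀ W, IsAff f W → W ≤ U → Γ(X, imageOpens f W) →+ Γ(N, W))
    (hmul : ∀ W hW hWU a b,
      e W hW hWU (a * b) = redMap f W b ^ p • e W hW hWU a + redMap f W a ^ p • e W hW hWU b)
    (hscalar : ∀ W hW hWU r, e W hW hWU (scalars f (imageOpens f W) r) = 0)
    (hres : ∀ W W' (hW : IsAff f W) (hW' : IsAff f W') (hWU : W ≤ U) (h : W' ≤ W) a,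
      res N h (e W hW hWU a) = e W' hW' (h.trans hWU) (resMap f (homOfLE h).op a)) :
    ∃ σ : homOn (frobKaehler (p := p) (redStr f)) N U, ∀ W hW hWU x,
      σ.1 ⟨W, hWU⟩ (frobPull (redStr f) _ W (kaehlerD (redStr f) W (redMap f W x))) =
        e W hW hWU x := by
  choose e₀ he₀ using fun W hW hWU ↦
    exists_descent hW (e W hW hWU) (hmul W hW hWU) (hscalar W hW hWU)
  have he₀mul (W hW hWU a b) :
      e₀ W hW hWU (a * b) = a ^ p • e₀ W hW hWU b + b ^ p • e₀ W hW hWU a := by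
    obtain ⟨a, rfl⟩ := redMap_surjective f hW a
    obtain ⟨b, rfl⟩ := redMap_surjective f hW b
    rw [← map_mul, he₀, he₀, he₀, hmul, add_comm]
  have he₀scalar (W hW hWU r) : e₀ W hW hWU (scalars (redStr f) W r) = 0 := by
    obtain ⟨r, rfl⟩ := residue_surjective (p := p) r
    rw [← redMap_scalars f W r, he₀, hscalar]
  have he₀res (W W') (hW : IsAff f W) (hW' : IsAff f W') (hWU : W ≤ U) (h : W' ≤ W) (s) :
      res N h (e₀ W hW hWU s) = e₀ W' hW' (h.trans hWU) (sres h s) := by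
    obtain ⟨a, rfl⟩ := redMap_surjective f hW s
    rw [he₀, ← redMap_resMap, he₀, hres _ _ _ hW']
  -- For an arbitrary open `V`, the value at `s` is glued over `U ∩ V` from the affine opens inside
  -- it. This yields a derivation of the whole structure sheaf into `j_* j^* N`, to which the
  -- universal property of `F^* Ω¹` applies.
  choose D hD using fun (V : (reduction f).Opens) (s : Γ(reduction f, V)) ↦
    exists_of_basis (N := N) (isBasisProp_isAff f) (U := cut U V)
      (fun W hW hWV ↦ e₀ W hW (hWV.trans (cut_le_left U V)) (sres (hWV.trans (cut_le_right U V)) s))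
      (fun W W' hW hW' hWV h ↦ by rw [he₀res _ _ _ hW', sres_sres])
  let D' (V : (reduction f).Opens) : Γ(reduction f, V) →+ Γ(extend N U, V) :=
    AddMonoidHom.mk' (fun s ↦ (ofExtend N U V).symm (D V s)) fun s t ↦ by
      rw [← map_add]
      refine congrArg _ (eq_of_basis (isBasisProp_isAff f) fun W hW hWV ↦ ?_)
      rw [map_add, hD _ _ _ hW, hD _ _ _ hW, hD _ _ _ hW, map_add, map_add]
  have hD' (V s) : ofExtend N U V (D' V s) = D V s := (ofExtend N U V).apply_symm_apply _
  suffices h : ∃ h : frobKaehler (p := p) (redStr f) ⟶ extend N U, ∀ V s,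
      h.app V (frobPull (redStr f) _ V (kaehlerD (redStr f) V s)) = D' V s by
    obtain ⟨h, hh⟩ := h
    refine ⟨ofExtendHom h, fun W hW hWU x ↦ ?_⟩
    rw [ofExtendHom_apply, hh, hD', hD _ _ _ hW, sres_refl, he₀]
  refine exists_frobKaehler_hom (p := p) (redStr f) (N := extend N U) D' ?_ ?_ ?_
  · intro V a b
    refine (ofExtend N U V).injective ?_
    rw [map_add, ofExtend_smul _ _ _ (cut_le_right U V), ofExtend_smul _ _ _ (cut_le_right U V),
      hD', hD', hD']
    refine eq_of_basis (isBasisProp_isAff f) fun W hW hWV ↦ ?_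
    rw [map_add, res_smul_sres, res_smul_sres, hD _ _ _ hW, hD _ _ _ hW, hD _ _ _ hW, map_mul, he₀mul,
      ← map_pow, ← map_pow]
    have hcut (s : Γ(reduction f, V)) : sres hWV
        ((reduction f).presheaf.map (homOfLE (cut_le_right U V)).op s) =
          sres (hWV.trans (cut_le_right U V)) s := sres_sres _ _ s
    rw [hcut, hcut]
  · intro V r
    refine (ofExtend N U V).injective ?_
    rw [hD', map_zero]
    refine eq_of_basis (isBasisProp_isAff f) fun W hW hWV ↦ ?_
    rw [hD _ _ _ hW, sres_scalars, he₀scalar, map_zero]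
  · intro V V' i a
    refine (ofExtend N U V').injective ?_
    rw [ofExtend_res N U i (cut_mono U i), hD', hD']
    refine eq_of_basis (isBasisProp_isAff f) fun W hW hWV ↦ ?_
    rw [res_res, hD _ _ _ hW, hD _ _ _ hW]
    exact congrArg _ (sres_sres i _ a)

end Descent

/-! ### Compatible lifts to `W₂` on smaller affine opens. -/

section WittLift

variable {p : ℕ} [hp : Fact p.Prime] {k : Type u} [Field k] [CharP k p]
  {X : Scheme.{u}} {f : X ⟶ Spec (CommRingCat.of (W₂ p k))}

/-- A lift `Γ(X, W) → W₂(Γ(X₀, W))` of the reduction map. -/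
abbrev IsLiftOn (W : (reduction f).Opens)
    (s : Γ(X, imageOpens f W) →+* TruncatedWittVector p 2 Γ(reduction f, W)) : Prop :=
  IsWittLift (scalars f (imageOpens f W)).hom (redMap f W).hom (scalars (redStr f) W).hom s

theorem wittMap_wittMap {A B C : Type u} [CommRing A] [CommRing B] [CommRing C] (g : A →+* B)
    (h : B →+* C) (r : TruncatedWittVector p 2 A) :
    wittMap h (wittMap g r) = wittMap (h.comp g) r := by
  refine truncatedWittVector_ext ?_ ?_ <;> simp only [wittMap_coeff, RingHom.comp_apply]

theorem resMap_resMap {U V W : (reduction f).Opens} (h : V ≤ U) (h' : W ≤ V)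
    (a : Γ(X, imageOpens f U)) :
    resMap f (homOfLE h').op (resMap f (homOfLE h).op a) = resMap f (homOfLE (h'.trans h)).op a :=
  (ConcreteCategory.congr_hom (X.presheaf.map_comp (homOfLE (imageOpens_mono f h)).op
    (homOfLE (imageOpens_mono f h')).op) a).symm

/-- A lift on an affine open subset extends compatibly to the smaller affine open subsets. -/
theorem exists_compatible_lifts {U : (reduction f).Opens} (hU : IsAff f U)
    {s : Γ(X, imageOpens f U) →+* TruncatedWittVector p 2 Γ(reduction f, U)} (hs : IsLiftOn U s) :
    ∃ t : ∀ W, IsAff f W → W ≤ U →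
        Γ(X, imageOpens f W) →+* TruncatedWittVector p 2 Γ(reduction f, W),
      (∀ W hW hWU, IsLiftOn W (t W hW hWU)) ∧
      ∀ W W' (hW : IsAff f W) (hW' : IsAff f W') (hWU : W ≤ U) (h : W' ≤ W) a,
        t W' hW' (h.trans hWU) (resMap f (homOfLE h).op a) = wittMap (sres h) (t W hW hWU a) := by
  have hτ (W) (hW : IsAff f W) (hWU : W ≤ U) :=
    formallyEtale_resMap f (homOfLE hWU).op hU hW
  choose t ht ht' using fun W hW hWU ↦ existsUnique_wittLift_extension hs (hτ W hW hWU)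
    (τ₀ := sres hWU) (π' := (redMap f W).hom) (RingHom.ext fun a ↦ redMap_resMap f hWU a)
  have hta (W hW hWU a) : t W hW hWU (resMap f (homOfLE hWU).op a) = wittMap (sres hWU) (s a) :=
    RingHom.congr_fun (ht W hW hWU).1 a
  refine ⟨t, fun W hW hWU ↦ ⟨RingHom.ext fun r ↦ ?_, (ht W hW hWU).2⟩, ?_⟩
  · have h1 : (scalars f (imageOpens f W)).hom r =
        resMap f (homOfLE hWU).op ((scalars f (imageOpens f U)).hom r) :=
      (ConcreteCategory.congr_hom (scalars_resMap f (homOfLE hWU).op) r).symm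
    refine (congrArg (t W hW hWU) h1).trans ((hta W hW hWU _).trans ?_)
    rw [hs.apply_structure, wittMap_wittMap]
    exact congrArg (fun g ↦ wittMap g r) (RingHom.ext (sres_scalars (redStr f) hWU))
  · intro W W' hW hW' hWU h a
    -- Restricting then lifting, and lifting then restricting, both extend the same map from `Γ(X,
    -- U)` to `W₂(Γ(X₀, W'))` and have the same reduction, so uniqueness along the étale map from
    -- `U` to `W` identifies them.
    have huniq := (existsUnique_wittLift_extension hs (hτ W hW hWU) (τ₀ := sres (h.trans hWU))
      (π' := (sres h).comp (redMap f W).hom) (RingHom.ext fun a ↦ by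
        refine (congrArg (sres h) (redMap_resMap f hWU a)).trans ?_
        exact sres_sres _ _ _)).unique
      (y₁ := (t W' hW' (h.trans hWU)).comp (resMap f (homOfLE h).op).hom)
      (y₂ := (wittMap (sres h)).comp (t W hW hWU)) ⟨?_, ?_⟩ ⟨?_, ?_⟩
    · exact RingHom.congr_fun huniq a
    · refine RingHom.ext fun b ↦ ?_
      refine Eq.trans ?_ (hta W' hW' (h.trans hWU) b)
      exact congrArg (t W' hW' (h.trans hWU)) (resMap_resMap hWU h b)
    · refine RingHom.ext fun b ↦ ?_
      refine (RingHom.congr_fun (ht W' hW' (h.trans hWU)).2 _).trans ?_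
      exact redMap_resMap f h b
    · refine RingHom.ext fun b ↦ ?_
      refine (congrArg (wittMap (sres h)) (hta W hW hWU b)).trans ?_
      rw [wittMap_wittMap]
      exact congrArg (fun g ↦ wittMap g (s b)) (RingHom.ext (sres_sres hWU h))
    · refine RingHom.ext fun b ↦ ?_
      refine (wittMap_coeff (sres h) _ 0).trans ?_
      exact congrArg (sres h) (RingHom.congr_fun (ht W hW hWU).2 b)

end WittLift

/-! ### Local splittings and exactness of the fundamental sequence. -/

section Fundamental

variable {p : ℕ} [hp : Fact p.Prime] {k : Type u} [Field k] [CharP k p]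
  {X : Scheme.{u}} (f : X ⟶ Spec (CommRingCat.of (W₂ p k)))

theorem dTot_map {U V : (reduction f).Opens} (h : V ≤ U) (a : Γ(X, imageOpens f U)) :
    res (total f) h (dTot f U a) = dTot f V (resMap f (homOfLE h).op a) := by
  refine (toSheafify_map (totPresheaf f) (homOfLE h) (dOn f U a)).symm.trans ?_
  exact congrArg (toSheafify (totPresheaf f) V) (totRes_d f (homOfLE h).op a)

/-- The map from total `p`-differentials to sections of the sheaf `Ω^{1,tot}`. -/
def totToSheaf (W : (reduction f).Opens) : TotOn f W →ₗ[Γ(reduction f, W)] Γ(total f, W) where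
  toFun := toSheafify (totPresheaf f) W
  map_add' := map_add (toSheafify (totPresheaf f) W)
  map_smul' := toSheafify_smul (totPresheaf f) W

theorem isTotalPDerivation_dTot (W : (reduction f).Opens) :
    IsTotalPDerivation p (scalars f (imageOpens f W)).hom (redMap f W).hom (dTot f W) := by
  have h := isTotalPDerivation_d p (scalars f (imageOpens f W)).hom (redMap f W).hom
  refine ⟨fun a b ↦ ?_, fun a b ↦ ?_, fun r c hrc ↦ ?_⟩
  · refine (congrArg (totToSheaf f W) (h.add a b)).trans ?_
    rw [map_add, map_add, map_smul]
    rfl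
  · refine (congrArg (totToSheaf f W) (h.mul a b)).trans ?_
    rw [map_add, map_smul, map_smul]
    rfl
  · refine (congrArg (totToSheaf f W) (h.scalar r c hrc)).trans ?_
    rw [map_smul]
    rfl

variable {f}

/-- The Frobenius-semilinear derivation `x ↦ dᵗᵒᵗ x - δ(x) dᵗᵒᵗ p`, where `δ` is the second component
of a lift to `W₂`. -/
def splitting {W : (reduction f).Opens}
    {s : Γ(X, imageOpens f W) →+* TruncatedWittVector p 2 Γ(reduction f, W)} (hs : IsLiftOn W s) :
    Γ(X, imageOpens f W) →+ Γ(total f, W) :=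
  AddMonoidHom.mk' (fun x ↦ dTot f W x - (s x).coeff 1 • dTot f W p) fun a b ↦ by
    -- Since `δ(p) = 1`, the `C_p` defects of `dᵗᵒᵗ` and of `δ(·) dᵗᵒᵗ p` are equal and cancel.
    rw [(isTotalPDerivation_dTot f W).add, hs.isTotalPDerivation.add, hs.coeff_one_natCast,
      smul_eq_mul, mul_one, add_smul, add_smul]
    abel

theorem splitting_apply {W : (reduction f).Opens}
    {s : Γ(X, imageOpens f W) →+* TruncatedWittVector p 2 Γ(reduction f, W)} (hs : IsLiftOn W s)
    (x : Γ(X, imageOpens f W)) :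
    splitting hs x = dTot f W x - (s x).coeff 1 • dTot f W p := rfl

theorem splitting_mul {W : (reduction f).Opens}
    {s : Γ(X, imageOpens f W) →+* TruncatedWittVector p 2 Γ(reduction f, W)} (hs : IsLiftOn W s)
    (a b : Γ(X, imageOpens f W)) :
    splitting hs (a * b) = redMap f W b ^ p • splitting hs a + redMap f W a ^ p • splitting hs b := by
  simp only [splitting_apply]
  rw [(isTotalPDerivation_dTot f W).mul, hs.isTotalPDerivation.mul, map_pow, map_pow, smul_sub,
    smul_sub, add_smul, smul_assoc, smul_assoc]
  abel

/-- On constants both terms equal `((φ(r) - r ^ p) / p) dᵗᵒᵗ p`, again because `δ(p) = 1`. -/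
theorem splitting_scalars {W : (reduction f).Opens}
    {s : Γ(X, imageOpens f W) →+* TruncatedWittVector p 2 Γ(reduction f, W)} (hs : IsLiftOn W s)
    (r : W₂ p k) : splitting hs (scalars f (imageOpens f W) r) = 0 := by
  obtain ⟨c, hc⟩ := exists_natCast_mul_eq r
  rw [splitting_apply]
  refine sub_eq_zero.2 (((isTotalPDerivation_dTot f W).scalar r c hc).trans ?_)
  refine congrArg (fun t : Γ(reduction f, W) ↦ t • dTot f W p) ?_
  refine Eq.trans ?_ (hs.isTotalPDerivation.scalar r c hc).symm
  rw [hs.coeff_one_natCast, smul_eq_mul, mul_one]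

theorem beta_splitting {W : (reduction f).Opens}
    {s : Γ(X, imageOpens f W) →+* TruncatedWittVector p 2 Γ(reduction f, W)} (hs : IsLiftOn W s)
    (x : Γ(X, imageOpens f W)) :
    (beta f).app W (splitting hs x) =
      frobPull (redStr f) _ W (kaehlerD (redStr f) W (redMap f W x)) := by
  have h : (beta f).app W ((s x).coeff 1 • dTot f W p) = 0 :=
    (congrArg (fun φ : structureSheaf (reduction f) ⟶ _ ↦ φ.app W ((s x).coeff 1)) (alpha_beta f))
  rw [splitting_apply, map_sub, h, sub_zero, beta_dTot]

variable (f)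

/-- Locally on `X₀`, the fundamental sequence splits. -/
theorem exists_local_section [Smooth f] {U : (reduction f).Opens} (hU : IsAff f U) :
    ∃ σ : homOn (frobKaehler (p := p) (redStr f)) (total f) U,
      (∀ V m, (beta f).app V.1 (σ.1 V m) = m) ∧
      ∀ W (_ : IsAff f W) (hWU : W ≤ U), ∃ s, ∃ hs : IsLiftOn W s, ∀ x,
        σ.1 ⟨W, hWU⟩ (frobPull (redStr f) _ W (kaehlerD (redStr f) W (redMap f W x))) =
          splitting hs x := by
  obtain ⟨s, hs⟩ := exists_isWittLift_scalars f hU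
  obtain ⟨t, ht, htres⟩ := exists_compatible_lifts hU hs
  obtain ⟨σ, hσ⟩ := exists_homOn_frobKaehler (fun W hW hWU ↦ splitting (ht W hW hWU))
    (fun W hW hWU ↦ splitting_mul (ht W hW hWU)) (fun W hW hWU ↦ splitting_scalars (ht W hW hWU))
    (fun W W' hW hW' hWU h a ↦ by
      rw [splitting_apply, splitting_apply, map_sub, res_smul_sres, dTot_map, dTot_map, htres _ _ hW hW',
        wittMap_coeff, map_natCast])
  refine ⟨σ, ?_, fun W hW hWU ↦ ⟨_, ht W hW hWU, hσ W hW hWU⟩⟩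
  let ψ : homOn (frobKaehler (p := p) (redStr f)) (frobKaehler (p := p) (redStr f)) U :=
    (homSheafMap _ (beta f)).hom.app (op U) σ
  let ι : homOn (frobKaehler (p := p) (redStr f)) (frobKaehler (p := p) (redStr f)) U :=
    ⟨fun _ ↦ LinearMap.id, fun _ _ _ _ ↦ rfl⟩
  -- `β ∘ σ` is the identity because it fixes the sections `F^* d x₀`: the correction term is a
  -- multiple of `dᵗᵒᵗ p`, which `β` kills.
  have h : ψ = ι := homOn_frobKaehler_ext fun W hW hWU x ↦
    (congrArg ((beta f).app W) (hσ W hW hWU x)).trans (beta_splitting _ x)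
  exact fun V m ↦ congrArg (fun φ : homOn _ _ U ↦ φ.1 V m) h

variable {f}

/-- The section of `β` and the retraction of `α` given by a lift to `W₂` are complementary. -/
theorem totToSheaf_eq {U W : (reduction f).Opens}
    {σ : homOn (frobKaehler (p := p) (redStr f)) (total f) U} (hWU : W ≤ U)
    {s : Γ(X, imageOpens f W) →+* TruncatedWittVector p 2 Γ(reduction f, W)} (hs : IsLiftOn W s)
    (hσ : ∀ x, σ.1 ⟨W, hWU⟩ (frobPull (redStr f) _ W (kaehlerD (redStr f) W (redMap f W x))) =
      splitting hs x) (m : TotOn f W) :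
    totToSheaf f W m = σ.1 ⟨W, hWU⟩ ((beta f).app W (totToSheaf f W m)) +
      lift hs.isTotalPDerivation m • dTot f W p := by
  let b : Γ(total f, W) →ₗ[Γ(reduction f, W)] Γ(frobKaehler (p := p) (redStr f), W) :=
    { toFun := (beta f).app W
      map_add' := map_add _
      map_smul' := (beta f).app_smul }
  have h : totToSheaf f W = (σ.1 ⟨W, hWU⟩ ∘ₗ b) ∘ₗ totToSheaf f W +
      (lift hs.isTotalPDerivation).smulRight (dTot f W p) := by
    refine hom_ext fun x ↦ ?_
    refine Eq.trans ?_ (congrArg₂ (· + ·) ((congrArg (σ.1 ⟨W, hWU⟩) (beta_dTot f W x)).trans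
      (hσ x)).symm (congrArg (· • dTot f W p) (lift_d hs.isTotalPDerivation x)).symm)
    rw [splitting_apply, sub_add_cancel]
    rfl
  exact LinearMap.congr_fun h m

variable (f)

/-- Where `s • dᵗᵒᵗ p` vanishes already in the presheaf, the retraction given by a local lift sends
it to `s`, so `s` vanishes locally. -/
theorem alpha_injective [Smooth f] (U : (reduction f).Opens) :
    Function.Injective ((alpha f).app U) := by
  refine (injective_iff_map_eq_zero ((alpha f).app U).hom).2 fun s hs ↦ ?_
  have hs' : toSheafify (totPresheaf f) U ((show Γ(reduction f, U) from s) • dOn f U p) = 0 :=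
    (toSheafify_smul (totPresheaf f) U _ _).trans hs
  choose V i hxV hV using fun x : U ↦
    exists_map_eq_zero_of_toSheafify_eq_zero (totPresheaf f) hs' x.2
  choose W hW hxW hWV using fun x : U ↦ exists_affine_le f (hxV x)
  refine eq_of_cover (N := structureSheaf (reduction f)) (fun x ↦ (hWV x).trans (i x).le)
    (fun x hx ↦ ⟨⟨x, hx⟩, hxW ⟨x, hx⟩⟩) fun x ↦ ?_
  obtain ⟨t, ht⟩ := exists_isWittLift_scalars f (hW x)
  have hzero : sres ((hWV x).trans (i x).le) (show Γ(reduction f, U) from s) •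
      dOn f (W x) p = 0 := by
    have h1 : (totPresheaf f).map (homOfLE ((hWV x).trans (i x).le)).op
        ((show Γ(reduction f, U) from s) • dOn f U p) = 0 := by
      have h2 := (totPresheaf f).map_comp (i x).op (homOfLE (hWV x)).op
      refine (congrArg (fun φ ↦ φ.hom ((show Γ(reduction f, U) from s) • dOn f U p)) h2).trans ?_
      exact (congrArg ((totPresheaf f).map (homOfLE (hWV x)).op).hom (hV x)).trans (map_zero _)
    refine Eq.trans ?_ h1
    refine Eq.trans ?_ ((totPresheaf f).map_smul _ _ _).symm
    refine congrArg _ (Eq.symm ((totRes_d f _ _).trans ?_))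
    exact congrArg (dOn f (W x)) (map_natCast (resMap f _).hom p)
  have h := congrArg (lift ht.isTotalPDerivation) hzero
  rw [map_smul, lift_d, ht.coeff_one_natCast, map_zero, smul_eq_mul, mul_one] at h
  exact h.trans (map_zero (res (structureSheaf (reduction f)) _)).symm

theorem exists_alpha_eq [Smooth f] (U : (reduction f).Opens) (m : Γ(total f, U))
    (hm : (beta f).app U m = 0) : ∃ n, (alpha f).app U n = m := by
  have hloc (x : U) : ∃ (W : (reduction f).Opens) (h : W ≤ U) (n : Γ(structureSheaf (reduction f), W)),
      x.1 ∈ W ∧ (alpha f).app W n = res (total f) h m := by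
    obtain ⟨V, hV, hxV, hVU⟩ := exists_affine_le f x.2
    obtain ⟨σ, -, hσ⟩ := exists_local_section f hV
    obtain ⟨V', i, m', hxV', hm'⟩ := exists_toSheafify_eq_res (totPresheaf f)
      (res (total f) hVU m) hxV
    obtain ⟨W, hW, hxW, hWV'⟩ := exists_affine_le f hxV'
    obtain ⟨s, hs, hσs⟩ := hσ W hW (hWV'.trans i)
    let m₀ : TotOn f W := (totPresheaf f).map (homOfLE hWV').op m'
    have hm₀ : totToSheaf f W m₀ = res (total f) (hWV'.trans (i.trans hVU)) m := by
      refine (toSheafify_map (totPresheaf f) (homOfLE hWV') m').trans ?_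
      refine (congrArg (res (total f) hWV') hm').trans ?_
      exact (congrArg (res (total f) hWV') (res_res _ _ m)).trans (res_res _ _ m)
    refine ⟨W, hWV'.trans (i.trans hVU), lift hs.isTotalPDerivation m₀, hxW, ?_⟩
    refine (alpha_app f W _).trans ?_
    -- Since `β m = 0`, the decomposition leaves only the multiple `δ(m) dᵗᵒᵗ p`.
    have h := totToSheaf_eq (hWV'.trans i) hs hσs m₀
    rw [hm₀, app_res, hm, map_zero, map_zero, zero_add] at h
    exact h.symm
  choose W hWU n hxW hn using hloc
  obtain ⟨a, ha⟩ := exists_of_cover hWU (fun x hx ↦ ⟨⟨x, hx⟩, hxW ⟨x, hx⟩⟩) n fun x y ↦ by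
    -- The local preimages depend on the chosen lifts only in appearance: injectivity of `α` makes
    -- them agree on overlaps.
    refine alpha_injective f _ ?_
    rw [app_res, app_res, hn, hn, res_res, res_res]
  refine ⟨a, eq_of_cover hWU (fun x hx ↦ ⟨⟨x, hx⟩, hxW ⟨x, hx⟩⟩) fun x ↦ ?_⟩
  rw [← app_res, ha, hn]

end Fundamental

end

end TotalPDiff

/-! ### The theorem. -/

theorem mainTheorem4 {p : ℕ} [Fact p.Prime] (hp : 2 < p) {k : Type u} [Field k] [CharP k p]
    {X : Scheme.{u}} (f : X ⟶ Spec (CommRingCat.of (TotalPDiff.W₂ p k))) [Smooth f] :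
    ∃ (hΩ : ((TotalPDiff.fundamental f).map
          (TotalPDiff.abelianSheaf (TotalPDiff.reduction f))).ShortExact)
      (hκ : (TotalPDiff.homSequence (TotalPDiff.fundamental f)).ShortExact),
      ∀ ω : TotalPDiff.Coh ((TotalPDiff.abelianSheaf (TotalPDiff.reduction f)).obj
          (TotalPDiff.frobKaehler (p := p) (TotalPDiff.redStr f))) 0,
        TotalPDiff.gaussManin f hΩ ω = TotalPDiff.cup ω (TotalPDiff.kodairaSpencer f hκ) := by
  have hinj := TotalPDiff.alpha_injective f
  have hex := TotalPDiff.exists_alpha_eq f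
  have hsec (x : TotalPDiff.reduction f) :
      ∃ (U : (TotalPDiff.reduction f).Opens) (σ : TotalPDiff.homOn _ _ U), x ∈ U ∧
        ∀ V m, (TotalPDiff.beta f).app V.1 (σ.1 V m) = m := by
    obtain ⟨U, hU, hxU, -⟩ := TotalPDiff.exists_affine_le f (U := ⊤) (x := x) trivial
    obtain ⟨σ, hσ, -⟩ := TotalPDiff.exists_local_section f hU
    exact ⟨U, σ, hxU, hσ⟩
  have hΩ := TotalPDiff.abelianSheaf_shortExact (S := TotalPDiff.fundamental f) hinj hex hsec
  have hκ := TotalPDiff.homSequence_shortExact (S := TotalPDiff.fundamental f) hinj hex hsec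
  exact ⟨hΩ, hκ, TotalPDiff.connecting_eq_cup_extensionClass hΩ hκ⟩
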